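/- **Setting.** Let $P$ be a poset on $[n]$ such that $i<_Pj\Rightarrow i<j$. A word $u$ over the positive integers is *packed* if its letters are exactly $1,\dots,\max(u)$; it encodes the set composition of its positions whose $k$-th block is $\{i\mid u_i=k\}$. For packed words, $v\le u$ means that the set composition of $v$ is obtained by merging adjacent blocks of that of $u$; $\mathrm{ev}(u)$ is the sequence of the block sizes. For a word $w$ over a totally ordered alphabet, $\mathrm{pack}(w)$ is obtained by replacing each letter by its rank among the letters of $w$. ${\bf WQSym}$ (over $\mathbb Q$) has the basis ${\bf M}_u$, $u$ packed, realized over a totally ordered alphabet $A$ as ${\bf M}_u(A)=\sum_{\mathrm{pack}(w)=u}w$. Put ${\bf G}_\sigma=\sum_{\mathrm{std}(u)=\sigma}{\bf M}_u$, ${\bf F}_\sigma={\bf G}_{\sigma^{-1}}$ and $$\Gamma_P=\sum_{\sigma\in L(P)}{\bf F}_\sigma,$$ where $L(P)$ is the set of linear extensions of $P$, i.e. of the permutations with $i<_Pj\Rightarrow\sigma^{-1}(i)<\sigma^{-1}(j)$. Let $C(P)$ (resp. $\dot C(P)$) be the set of packed words $u$ of length $n$ with $i<_Pj\Rightarrow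 u_i\le u_j$ (resp. $u_i<u_j$). Let $$C_P=\{x\in\mathbb R^n\mid x_i\ge0,\ i<_Pj\Rightarrow x_i\le x_j\},\qquad Q_P=C_P\cap[0,1]^n$$ be the cone and the order polytope of $P$. Write $|x|=x_1+\dots+x_n$, and identify $x\in\mathbb Z^n$ with the word $a_{x_1}\cdots a_{x_n}$. Let $A=\{a_0,a_1,a_2,\dots\}$ and $A'=\{a_1,a_2,\dots\}$. The change of sign $f(A)\mapsto f(-A)$ on ${\bf WQSym}$ is the adjoint of $g\mapsto g*\sigma_1(-A)$ on ${\bf WQSym}^*$. Here ${\bf N}_u$ is the basis dual to ${\bf M}_u$; the internal product is ${\bf N}_v*{\bf N}_w={\bf N}_{\mathrm{pack}(v,w)}$, the word of the biletters $(v_i,w_i)$ being packed for the lexicographic order; and $\sigma_1(-A)=\sigma_1(A)^{-1}$, with ${\bf Sym}\subset{\bf WQSym}^*$ through $S^I=\sum_{\mathrm{ev}(w)=I}{\bf N}_w$. For $\alpha\in\mathbb Q$ let $\Gamma_P(\alpha)$ be the image of $\Gamma_P$ under ${\bf M}_u\mapsto\binom{\alpha}{\max(u)}$. For a virtual commutative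 alphabet $X$ given by a series $\sigma_1(XA)=\sum_IM_I(X)S^I$, let $\Gamma_P(X)$ be its image under ${\bf M}_u\mapsto M_{\mathrm{ev}(u)}(X)$. With $\sigma_y(A)=\sum_ky^kS_k$ and $\lambda_{-y}(A)=\sigma_y(A)^{-1}$, let $X_{q,t}$ be the virtual alphabet $$\sigma_1(X_{q,t}A)=\prod_{i\ge0}^{\rightarrow}\sigma_{q^i}(A)\ \prod_{j\ge1}^{\leftarrow}\lambda_{-q^jt}(A),$$ where $t\in\mathbb Q((q))$ and the products are taken coefficientwise in the topology of $\mathbb Q((q))$. Put $[m]_q=\frac{q^m-1}{q-1}$ for $m\in\mathbb Z$. **Statement.** 1. (Noncommutative Ehrhart polynomial.) $\Gamma_P=\sum_{u\in C(P)}{\bf M}_u$. Moreover $\Gamma_P(A)=\sum_{x\in C_P\cap\mathbb Z^n}x$, and for all $m\ge0$, $\Gamma_P(\{a_0,\dots,a_m\})=\sum_{x\in mQ_P\cap\mathbb Z^n}x$. 2. (Noncommutative reciprocity.) For each packed word $u$ of length $n$, ${\bf M}_u(-A)=(-1)^{\max(u)}\sum_{v\le u}{\bf M}_v(A)$. In ${\bf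 WQSym}$, and hence over the alphabet $A'$, $$(-1)^n\Gamma_P(-A')=\sum_{v\in\dot C(P)}{\bf M}_v(A'),$$ and this is the sum of the integer points of the interior of $C_P$. For $m\ge1$, $(-1)^n\Gamma_P(-\{a_1,\dots,a_{m-1}\})$ is the sum of the integer points of the interior of $mQ_P$. 3. (Ehrhart reciprocity.) There is a unique $E\in\mathbb Q[x]$ with $E(m)=\#(mQ_P\cap\mathbb Z^n)$ for all integers $m\ge0$. It satisfies $E(\alpha)=\Gamma_P(\alpha+1)$ for all $\alpha\in\mathbb Q$, and for $m\ge1$ $$(-1)^nE(-m)=(-1)^n\Gamma_P(1-m)=\#(\mathrm{int}(mQ_P)\cap\mathbb Z^n).$$ 4. ($q$-specialisations.) Both infinite products above converge for every $t\in\mathbb Q((q))$. For $m\ge0$, $$\sigma_1(X_{q,q^m}A)=\sigma_1\sigma_q\cdots\sigma_{q^m}\quad\text{and}\quad\Gamma_P(X_{q,q^m})=\sum_{x\in mQ_P\cap\mathbb Z^n}q^{|x|}.$$ For $m\ge1$, $\sigma_1(X_{q,q^{-m}}A)=\lambda_{-q^{-1}}\lambda_{-q^{-2}}\cdots\lambda_{-q^{-(m-1)}}$;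 moreover $\Gamma_P(X_{q,q^{-m}})$ is obtained from $\Gamma_P(-\{a_1,\dots,a_{m-1}\})$ by $a_i\mapsto q^{-i}$, and $$(-1)^n\Gamma_P(X_{q,q^{-m}})=\sum_{x\in\mathrm{int}(mQ_P)\cap\mathbb Z^n}q^{-|x|}.$$ 5. (Chapoton's $q$-Ehrhart polynomial and series.) There is $L\in\mathbb Q(q)[x]$ with $\Gamma_P(X_{q,t})=L(x)$ for $t=1+(q-1)x$ and all $x\in\mathbb Q((q))$. It is the unique polynomial in $\mathbb Q(q)[x]$ with $L([m]_q)=\sum_{z\in mQ_P\cap\mathbb Z^n}q^{|z|}$ for all $m\ge0$, so that $\sum_{m\ge0}L([m]_q)T^m$ is the $q$-Ehrhart series $\sum_{m\ge0}\bigl(\sum_{z\in mQ_P\cap\mathbb Z^n}q^{|z|}\bigr)T^m$ of $Q_P$. For $m\ge1$, $(-1)^nL([-m]_q)=\sum_{z\in\mathrm{int}(mQ_P)\cap\mathbb Z^n}q^{-|z|}$. -/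

import Mathlib

open Filter Topology Polynomial
open scoped Pointwise LaurentSeries

noncomputable section

namespace NCEhrhart

/-! ### Packed words -/

/-- The packing of a word `w` over a totally ordered alphabet: every letter is replaced by its
rank (starting at `1`) among the letters that occur in `w`. -/
def packVal {n : ℕ} {α : Type*} [LinearOrder α] (w : Fin n → α) (i : Fin n) : ℕ :=
  ((Finset.univ.image w).filter (fun a => a ≤ w i)).card

/-- The maximal letter `max u` of a word `u` over the positive integers (`0` for the empty word). -/
def maxLetter {n : ℕ} (u : Fin n → ℕ) : ℕ := Finset.univ.sup u

/-- A word of length `n` over the positive integers is packed if its letters are exactly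
`1, 2, …, max u`. The packed word `u` encodes the set composition of the set of positions whose
`k`-th block is `{i | u i = k}`. -/
def PackedWord (n : ℕ) : Type :=
  {u : Fin n → ℕ // Finset.univ.image u = Finset.Icc 1 (maxLetter u)}

theorem packVal_lt {n : ℕ} {α : Type*} [LinearOrder α] (w : Fin n → α) {i j : Fin n}
    (h : w i < w j) : packVal w i < packVal w j := by
  unfold packVal
  apply Finset.card_lt_card
  rw [Finset.ssubset_iff_of_subset]
  · exact ⟨w j, by simp, by simp [h]⟩
  · intro a ha
    simp only [Finset.mem_filter] at ha ⊢
    exact ⟨ha.1, ha.2.trans h.le⟩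

theorem packVal_packed {n : ℕ} {α : Type*} [LinearOrder α] (w : Fin n → α) :
    Finset.univ.image (packVal w) = Finset.Icc 1 (maxLetter (packVal w)) := by
  set s := Finset.univ.image w with hs
  have hle : ∀ i, packVal w i ≤ s.card := fun i => Finset.card_filter_le _ _
  have hpos : ∀ i, 1 ≤ packVal w i := fun i =>
    Finset.card_pos.mpr ⟨w i, by simp⟩
  have hsub : Finset.univ.image (packVal w) ⊆ Finset.Icc 1 s.card := by
    intro k hk
    obtain ⟨i, -, rfl⟩ := Finset.mem_image.mp hk
    exact Finset.mem_Icc.mpr ⟨hpos i, hle i⟩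
  have hcard : s.card ≤ (Finset.univ.image (packVal w)).card := by
    have h1 : Finset.univ.image (packVal w)
        = s.image (fun a => (s.filter (fun b => b ≤ a)).card) := by
      rw [hs, Finset.image_image]
      rfl
    rw [h1]
    refine (Finset.card_image_of_injOn ?_).ge
    intro a ha b hb hab
    simp only [Finset.mem_coe, hs, Finset.mem_image, Finset.mem_univ, true_and] at ha hb
    obtain ⟨i, rfl⟩ := ha
    obtain ⟨j, rfl⟩ := hb
    rcases lt_trichotomy (w i) (w j) with h | h | h
    · exact absurd hab (packVal_lt w h).ne
    · exact h
    · exact absurd hab (packVal_lt w h).ne'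
  have heq : Finset.univ.image (packVal w) = Finset.Icc 1 s.card :=
    Finset.eq_of_subset_of_card_le hsub (by simpa using hcard)
  have hmax : maxLetter (packVal w) = s.card := by
    apply le_antisymm
    · exact Finset.sup_le fun i _ => hle i
    · rcases Nat.eq_zero_or_pos s.card with h0 | h0
      · omega
      · have : s.card ∈ Finset.univ.image (packVal w) := by
          rw [heq]; exact Finset.mem_Icc.mpr ⟨h0, le_rfl⟩
        obtain ⟨i, -, hi⟩ := Finset.mem_image.mp this
        rw [← hi]
        exact Finset.le_sup (f := packVal w) (Finset.mem_univ i)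
  rw [heq, hmax]

/-- The packed word `pack w` of a word `w`. -/
def pack {n : ℕ} {α : Type*} [LinearOrder α] (w : Fin n → α) : PackedWord n :=
  ⟨packVal w, packVal_packed w⟩

instance packedWordFinite (n : ℕ) : Finite (PackedWord n) := by
  have hb : ∀ (u : PackedWord n) (i : Fin n), u.1 i < n + 1 := by
    intro u i
    have h1 : (Finset.univ.image u.1).card ≤ n := by
      simpa using Finset.card_image_le (s := (Finset.univ : Finset (Fin n))) (f := u.1)
    rw [u.2, Nat.card_Icc] at h1
    have h2 : u.1 i ≤ maxLetter u.1 := Finset.le_sup (f := u.1) (Finset.mem_univ i)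
    omega
  refine Finite.of_injective
    (fun u : PackedWord n => fun i : Fin n => (⟨u.1 i, hb u i⟩ : Fin (n + 1))) ?_
  intro u v h
  apply Subtype.ext
  funext i
  exact congrArg Fin.val (congrFun h i)

instance packedWordFintype (n : ℕ) : Fintype (PackedWord n) := Fintype.ofFinite _

instance packedWordDecidableEq (n : ℕ) : DecidableEq (PackedWord n) := Classical.decEq _

theorem block_pos {n : ℕ} (u : PackedWord n) (k : Fin (maxLetter u.1)) :
    0 < (Finset.univ.filter (fun i => u.1 i = (k : ℕ) + 1)).card := by
  have : (k : ℕ) + 1 ∈ Finset.univ.image u.1 := by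
    rw [u.2]
    exact Finset.mem_Icc.mpr ⟨by omega, by have := k.2; omega⟩
  obtain ⟨i, -, hi⟩ := Finset.mem_image.mp this
  exact Finset.card_pos.mpr ⟨i, by simp [hi]⟩

/-- The evaluation of a packed word: the composition of `n` whose `k`-th part is the number of
occurrences of the letter `k`. -/
def evaluation {n : ℕ} (u : PackedWord n) : List ℕ+ :=
  List.ofFn fun k : Fin (maxLetter u.1) =>
    (⟨(Finset.univ.filter (fun i => u.1 i = (k : ℕ) + 1)).card, block_pos u k⟩ : ℕ+)

/-- The refinement order on packed words: `v ≤ u` iff the set composition encoded by `v` is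
obtained by merging adjacent blocks of the one encoded by `u`, that is, iff `v = f ∘ u` for some
weakly increasing `f`. -/
def Refines {n : ℕ} (v u : PackedWord n) : Prop :=
  ∀ i j, u.1 i ≤ u.1 j → v.1 i ≤ v.1 j

/-- The finite set of the packed words `v ≤ u`. -/
def coarsenings {n : ℕ} (u : PackedWord n) : Finset (PackedWord n) := by
  classical exact Finset.univ.filter (fun v => Refines v u)

/-! ### `WQSym`, `FQSym` and realizations over alphabets -/

/-- The homogeneous component of degree `n` of `WQSym`: the free module on the packed words of
length `n`. -/
abbrev WQSym (n : ℕ) : Type := PackedWord n →₀ ℚ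

/-- The basis element `M_u` of `WQSym`. -/
def M {n : ℕ} (u : PackedWord n) : WQSym n := Finsupp.single u 1

/-- The value of an element of `WQSym` on the ordered alphabet `{a_i | i ∈ S}`, `S ⊆ ℤ`. Here
`M_u(A)` is the formal sum of all words `w` over `A` with `pack w = u`. The word
`a_{x_1} ⋯ a_{x_n}` is identified with the integer vector `x`, and a (possibly infinite) formal
sum of words of length `n` with the function giving the coefficient of each word. -/
def onAlphabet {n : ℕ} (S : Set ℤ) (f : WQSym n) : (Fin n → ℤ) → ℚ := by
  classical exact fun w => if ∀ i, w i ∈ S then f (pack w) else 0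

/-- The formal sum `∑_{x ∈ X} a_{x_1} ⋯ a_{x_n}` of a set of integer vectors, read as words. -/
def sumOfWords {n : ℕ} (X : Set (Fin n → ℤ)) : (Fin n → ℤ) → ℚ := X.indicator 1

/-- The homogeneous component of degree `n` of `FQSym`, with basis `F_σ`. -/
abbrev FQSym (n : ℕ) : Type := Equiv.Perm (Fin n) →₀ ℚ

/-- The basis element `F_σ` of `FQSym`. -/
def F {n : ℕ} (σ : Equiv.Perm (Fin n)) : FQSym n := Finsupp.single σ 1

/-- The standardization of a word: positions are numbered by increasing letter, and from left to
right for equal letters. It is the inverse of the permutation that sorts the word stably. -/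
def std {n : ℕ} (u : Fin n → ℕ) : Equiv.Perm (Fin n) := (Tuple.sort u)⁻¹

/-- `G_σ = ∑_{std u = σ} M_u`. -/
def G {n : ℕ} (σ : Equiv.Perm (Fin n)) : WQSym n :=
  ∑ u ∈ Finset.univ.filter (fun u : PackedWord n => std u.1 = σ), M u

/-- The embedding of `FQSym` into `WQSym`; it sends `F_σ = G_{σ⁻¹}` to `∑_{std u = σ⁻¹} M_u`. -/
def embedFQSym {n : ℕ} : FQSym n →ₗ[ℚ] WQSym n :=
  Finsupp.lift (WQSym n) ℚ (Equiv.Perm (Fin n)) (fun σ => G σ⁻¹)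

/-! ### Posets

A poset `P` on `{1, …, n}` (here `Fin n`) is given by its strict order relation: `P i j` stands
for `i <_P j`. -/

/-- The linear extensions of `P`: the permutations `σ`, read as the words `σ(1) ⋯ σ(n)`, such that
`i` stands to the left of `j` whenever `i <_P j`. -/
def linearExtensions {n : ℕ} (P : Fin n → Fin n → Prop) : Finset (Equiv.Perm (Fin n)) := by
  classical exact Finset.univ.filter (fun σ => ∀ i j, P i j → σ⁻¹ i < σ⁻¹ j)

/-- The free generating function `Γ_P = ∑_{σ ∈ L(P)} F_σ` in `FQSym`. -/
def gammaFQSym {n : ℕ} (P : Fin n → Fin n → Prop) : FQSym n := ∑ σ ∈ linearExtensions P, F σ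

/-- The free generating function `Γ_P`, as an element of `WQSym`. -/
def gamma {n : ℕ} (P : Fin n → Fin n → Prop) : WQSym n := embedFQSym (gammaFQSym P)

/-- `C(P)`: the packed words `u` with `u_i ≤ u_j` whenever `i <_P j`. -/
def weakWords {n : ℕ} (P : Fin n → Fin n → Prop) : Finset (PackedWord n) := by
  classical exact Finset.univ.filter (fun u => ∀ i j, P i j → u.1 i ≤ u.1 j)

/-- `Ċ(P)`: the packed words `u` with `u_i < u_j` whenever `i <_P j`. -/
def strictWords {n : ℕ} (P : Fin n → Fin n → Prop) : Finset (PackedWord n) := by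
  classical exact Finset.univ.filter (fun u => ∀ i j, P i j → u.1 i < u.1 j)

/-- The cone `C_P`. -/
def cone {n : ℕ} (P : Fin n → Fin n → Prop) : Set (Fin n → ℝ) :=
  {x | (∀ i, 0 ≤ x i) ∧ ∀ i j, P i j → x i ≤ x j}

/-- The order polytope `Q_P`. -/
def orderPolytope {n : ℕ} (P : Fin n → Fin n → Prop) : Set (Fin n → ℝ) :=
  {x | (∀ i, 0 ≤ x i ∧ x i ≤ 1) ∧ ∀ i j, P i j → x i ≤ x j}

/-- The integer points of a subset of `ℝⁿ`. -/
def integerPoints {n : ℕ} (X : Set (Fin n → ℝ)) : Set (Fin n → ℤ) :=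
  {z | (fun i => (z i : ℝ)) ∈ X}

theorem finite_integerPoints {n : ℕ} (P : Fin n → Fin n → Prop) (m : ℕ) :
    (integerPoints ((m : ℝ) • orderPolytope P)).Finite := by
  refine (Set.Finite.pi' (fun _ : Fin n => Set.finite_Icc (0 : ℤ) (m : ℤ))).subset ?_
  intro z hz i
  obtain ⟨x, hx, hxz⟩ := Set.mem_smul_set.mp hz
  have h : (m : ℝ) * x i = (z i : ℝ) := congrFun hxz i
  have h0 := (hx.1 i).1
  have h1 := (hx.1 i).2
  have hm : (0 : ℝ) ≤ m := Nat.cast_nonneg m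
  constructor
  · have : (0 : ℝ) ≤ (z i : ℝ) := by rw [← h]; positivity
    exact_mod_cast this
  · have : (z i : ℝ) ≤ (m : ℝ) := by rw [← h]; nlinarith
    exact_mod_cast this

theorem finite_interiorPoints {n : ℕ} (P : Fin n → Fin n → Prop) (m : ℕ) :
    (integerPoints (interior ((m : ℝ) • orderPolytope P))).Finite :=
  (finite_integerPoints P m).subset fun z hz =>
    show (fun i => (z i : ℝ)) ∈ (m : ℝ) • orderPolytope P from interior_subset hz

/-- The integer points of `m Q_P`. -/
def points {n : ℕ} (P : Fin n → Fin n → Prop) (m : ℕ) : Finset (Fin n → ℤ) :=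
  (finite_integerPoints P m).toFinset

/-- The integer points of the interior of `m Q_P`. -/
def interiorPoints {n : ℕ} (P : Fin n → Fin n → Prop) (m : ℕ) : Finset (Fin n → ℤ) :=
  (finite_interiorPoints P m).toFinset

/-! ### Noncommutative symmetric functions -/

/-- A formal series `∑_I c_I S^I` in noncommutative symmetric functions, given by its coefficients
on the products `S^I = S_{i_1} ⋯ S_{i_r}`, where `I = (i_1, …, i_r)` runs over all compositions. -/
abbrev SymSeries (R : Type*) : Type _ := List ℕ+ → R

namespace SymSeries

variable {R : Type*} [CommRing R]

/-- The series `1`. -/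
def one : SymSeries R := fun I => if I = [] then 1 else 0

/-- The product of series, with `S^I S^J = S^{IJ}`. -/
def mul (f g : SymSeries R) : SymSeries R :=
  fun I => ∑ k ∈ Finset.range (I.length + 1), f (I.take k) * g (I.drop k)

/-- `σ_y(A) = ∑_{k ≥ 0} y^k S_k`. -/
def sigma (y : R) : SymSeries R
  | [] => 1
  | [k] => y ^ (k : ℕ)
  | _ :: _ :: _ => 0

/-- `λ_{-y}(A) = σ_y(A)⁻¹ = ∑_I (-1)^{ℓ(I)} y^{|I|} S^I`. -/
def lambdaNeg (y : R) : SymSeries R :=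
  fun I => (-1) ^ I.length * y ^ (I.map (fun k : ℕ+ => (k : ℕ))).sum

theorem sigma_mul_lambdaNeg (y : R) : mul (sigma y) (lambdaNeg y) = one := by
  funext I
  rcases I with _ | ⟨a, I⟩
  · simp [mul, sigma, lambdaNeg, one]
  · have h : ∀ k, sigma y ((a :: I).take (k + 1 + 1)) * lambdaNeg y ((a :: I).drop (k + 1 + 1))
        = if I = [] then lambdaNeg y [] * y ^ (a : ℕ) else 0 := by
      intro k
      rcases I with _ | ⟨b, I⟩
      · simp [sigma, mul_comm]
      · simp [sigma]
    unfold mul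
    rw [List.length_cons, Finset.sum_range_succ', Finset.sum_range_succ']
    rcases I with _ | ⟨b, I⟩
    · simp [sigma, lambdaNeg, one]
    · rw [Finset.sum_eq_zero (fun k _ => by rw [h k]; simp)]
      simp [sigma, lambdaNeg, one, pow_succ, pow_add]
      ring

theorem lambdaNeg_mul_sigma (y : R) : mul (lambdaNeg y) (sigma y) = one := by
  funext I
  rcases List.eq_nil_or_concat I with rfl | ⟨I, a, rfl⟩
  · simp [mul, sigma, lambdaNeg, one]
  · unfold mul
    rw [List.length_concat, Finset.sum_range_succ, Finset.sum_range_succ, Finset.sum_eq_zero]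
    · simp [sigma, lambdaNeg, one, pow_succ, pow_add]
      ring
    · intro k hk
      have hk' := Finset.mem_range.mp hk
      have h2 : 2 ≤ ((I ++ [a]).drop k).length := by
        rw [List.length_drop, List.length_append, List.length_singleton]; omega
      rcases hd : (I ++ [a]).drop k with _ | ⟨b, _ | ⟨c, J⟩⟩
      · simp [hd] at h2
      · simp [hd] at h2
      · simp [hd, sigma]

/-- The finite product `g_0 g_1 ⋯ g_{N-1}`, in this order from left to right. -/
def prodRight (g : ℕ → SymSeries R) : ℕ → SymSeries R
  | 0 => one
  | N + 1 => mul (prodRight g N) (g N)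

/-- The finite product `g_{N-1} ⋯ g_1 g_0`, in this order from left to right. -/
def prodLeft (g : ℕ → SymSeries R) : ℕ → SymSeries R
  | 0 => one
  | N + 1 => mul (g N) (prodLeft g N)

/-- The infinite product `g_0 g_1 g_2 ⋯`: the limit of the finite products, coefficient by
coefficient. -/
def infProdRight [TopologicalSpace R] (g : ℕ → SymSeries R) : SymSeries R :=
  fun I => limUnder atTop (fun N => prodRight g N I)

/-- The infinite product `⋯ g_2 g_1 g_0`: the limit of the finite products, coefficient by
coefficient. -/
def infProdLeft [TopologicalSpace R] (g : ℕ → SymSeries R) : SymSeries R :=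
  fun I => limUnder atTop (fun N => prodLeft g N I)

end SymSeries

/-! ### Change of sign of the alphabet -/

/-- The internal product of `WQSym^*` on its basis `N_u` dual to `M_u`: one has
`N_v * N_w = N_{pack(v, w)}`, where the word of the biletters `(v_i, w_i)` is packed for the
lexicographic order. -/
def internalProduct {n : ℕ} (v w : PackedWord n) : PackedWord n :=
  pack (fun i => toLex (v.1 i, w.1 i))

/-- The coefficient of `N_w` in `σ_1(-A) = σ_1(A)⁻¹`, where noncommutative symmetric functions are
embedded in `WQSym^*` by sending `S^I` to the sum of the `N_w` with `w` of evaluation `I`. -/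
def sigmaNegCoeff {n : ℕ} (w : PackedWord n) : ℚ :=
  SymSeries.lambdaNeg (1 : ℚ) (evaluation w)

/-- The change of sign `f(A) ↦ f(-A)` on `WQSym`: the adjoint of the right internal multiplication
by `σ_1(-A)` on `WQSym^*`, that is, `M_u(-A) = ∑_v ⟨M_u, N_v * σ_1(-A)⟩ M_v(A)`. -/
def negAlphabet {n : ℕ} : WQSym n →ₗ[ℚ] WQSym n :=
  Finsupp.lift (WQSym n) ℚ (PackedWord n) (fun u =>
    ∑ v, (∑ w ∈ Finset.univ.filter (fun w => internalProduct v w = u), sigmaNegCoeff w) • M v)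

/-! ### Scalar and `q`-specializations -/

/-- The specialization at a scalar `α` (a binomial element): the commutative image of `M_u` is the
quasi-symmetric function `M_I` with `I` the evaluation of `u`, and `M_I(α) = α choose ℓ(I)`. -/
def atScalar {n : ℕ} (α : ℚ) (f : WQSym n) : ℚ :=
  f.sum fun u c => c * Ring.choose α (evaluation u).length

/-- The specialization of an element of `WQSym` at a (virtual) commutative alphabet `X` given by
the series `σ_1(XA) = ∑_I M_I(X) S^I`. -/
def atSeries {n : ℕ} {K : Type*} [Field K] [Algebra ℚ K] (X : SymSeries K) (f : WQSym n) : K :=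
  f.sum fun u c => algebraMap ℚ K c * X (evaluation u)

/-- The indeterminate `q`, in the field `ℚ((q))` of formal Laurent series. -/
def qL : ℚ⸨X⸩ := HahnSeries.single 1 1

section
open RatFunc
/-- The inclusion `k(q) ⊆ k((q))`. -/
def ratToLaurent (k : Type*) [Field k] : RatFunc k →+* k⸨X⸩ := algebraMap (RatFunc k) k⸨X⸩
end

/-- The indeterminate `q`, in the field `ℚ(q)`. -/
def qR : RatFunc ℚ := RatFunc.X

/-- The virtual alphabet `X_{q,t} = (1 - qt)/(1 - q)`, that is
`σ_1(X_{q,t} A) = (σ_1 σ_q σ_{q²} ⋯) (⋯ λ_{-q³t} λ_{-q²t} λ_{-qt})`. -/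
def alphabetQT (t : ℚ⸨X⸩) : SymSeries ℚ⸨X⸩ :=
  SymSeries.mul
    (SymSeries.infProdRight fun i => SymSeries.sigma (qL ^ i))
    (SymSeries.infProdLeft fun j => SymSeries.lambdaNeg (qL ^ (j + 1) * t))

/-- The `q`-integer `[m]_q = (q^m - 1)/(q - 1)` in `ℚ(q)`, for `m` in `ℤ`. -/
def qInt (m : ℤ) : RatFunc ℚ := (qR ^ m - 1) / (qR - 1)

/-- The `q`-counting of the integer points of `m Q_P` by the sum of the coordinates. -/
def qCount {n : ℕ} (P : Fin n → Fin n → Prop) (m : ℕ) : RatFunc ℚ :=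
  ∑ z ∈ points P m, qR ^ (∑ i, z i)

/-- The `q`-Ehrhart series `∑_{m ≥ 0} (∑_{z ∈ m Q_P ∩ ℤⁿ} q^{z_1 + ⋯ + z_n}) T^m`. -/
def qEhrhartSeries {n : ℕ} (P : Fin n → Fin n → Prop) : PowerSeries (RatFunc ℚ) :=
  PowerSeries.mk fun m => qCount P m

end NCEhrhart

end

open NCEhrhart

namespace NCEhrhart

variable {n : ℕ} {α β : Type*}

/-! ### Packing -/

/-! For positions `i < j`, standardization puts `i` before `j` exactly when `u i ≤ u j`. As the
labelling of `P` is natural, the words in `C(P)` are the disjoint union of the standardization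
classes attached to linear extensions (`gamma_eq_sum_weakWords`). A vector satisfies the weak
(strict) inequalities of `P` iff its packing does, so expansions in the `M_u` turn into sums of
lattice points of the closed (open) cone or polytope.

Reciprocity rests on two signed counts for a relation compatible with the order of positions: the
sum of `(-1)^max` is `(-1)^n` over strict words (`sum_sign_strictWords`), and `0` over weak words if
the relation is nonempty (`sum_sign_weakWords`). Both come from the involution `toggle`, which
merges a singleton block `{a}` with the next block or splits it off again. The coefficient of `M_v`
in `Γ_P(-A)` is the signed count of the `w` such that the biletters `(v_i, w_i)` increase weakly
along `P` lexicographically. If `v` is strict, `w` is free and the count is `(-1)^n`; if `v` is weak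
but not strict, `w` is weak for a nonempty subrelation and the count is `0`; otherwise there is no
such `w`.

In a product of series `σ_y`, the coefficient of `S^I` is a sum of monomials over strictly
increasing index sequences; for `λ_{-y}` the sequences are weakly increasing and a sign appears.
Summed over `C(P)`, these become weighted sums over words on an interval: lattice points in the
first case, `Γ_P(-A)` in the second. Setting all variables to `1` gives binomial coefficients, hence
the Ehrhart polynomial.

For `X_{q,t}`, explicit series `qSigma` and `qLambda` satisfy functional equations under `A ↦ qA`
and are mutually inverse, so every finite product telescopes. In the limit `σ_1(X_{q,t}A)` is
`qSigma(A)` times `qLambda(qtA)`: each coefficient is a polynomial in `t` over `ℚ(q)`, and `t = q^m`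
or `q^{-m}` gives back finite products. -/

theorem card_image_le_of_factors {ι : Type*} [DecidableEq α] [DecidableEq β] (s : Finset ι)
    (f : ι → α) (g : ι → β) (h : ∀ i j, g i = g j → f i = f j) :
    (s.image f).card ≤ (s.image g).card := by
  rcases s.eq_empty_or_nonempty with rfl | ⟨i₀, -⟩
  · simp
  have hf : ∀ i, Function.extend g f (fun _ => f i₀) (g i) = f i := fun i =>
    Function.FactorsThrough.extend_apply (fun a b hab => h a b hab) _ i
  have : s.image f = (s.image g).image (Function.extend g f (fun _ => f i₀)) := by
    rw [Finset.image_image]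
    exact Finset.image_congr fun i _ => (hf i).symm
  rw [this]
  exact Finset.card_image_le

theorem card_image_congr_of_factors {ι : Type*} [DecidableEq α] [DecidableEq β] (s : Finset ι)
    (f : ι → α) (g : ι → β) (h : ∀ i ∈ s, ∀ j ∈ s, g i = g j ↔ f i = f j) :
    (s.image f).card = (s.image g).card := by
  have h1 : s.image f = s.attach.image (fun i : s => f i) := by
    ext a
    simp
  have h2 : s.image g = s.attach.image (fun i : s => g i) := by
    ext a
    simp
  rw [h1, h2]
  exact le_antisymm
    (card_image_le_of_factors _ _ _ fun i j => (h i i.2 j j.2).1)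
    (card_image_le_of_factors _ _ _ fun i j => (h i i.2 j j.2).2)

variable [LinearOrder α] [LinearOrder β]

theorem packVal_eq_card_image (w : Fin n → α) (i : Fin n) :
    packVal w i = ((Finset.univ.filter (fun j => w j ≤ w i)).image w).card := by
  unfold packVal
  rw [Finset.filter_image]

theorem packVal_lt_iff (w : Fin n → α) (i j : Fin n) :
    packVal w i < packVal w j ↔ w i < w j := by
  refine ⟨fun h => ?_, packVal_lt w⟩
  rcases lt_trichotomy (w i) (w j) with h1 | h1 | h1
  · exact h1
  · unfold packVal at h
    rw [h1] at h
    exact absurd h (lt_irrefl _)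
  · exact absurd (packVal_lt w h1) h.not_gt

theorem packVal_le_iff (w : Fin n → α) (i j : Fin n) :
    packVal w i ≤ packVal w j ↔ w i ≤ w j := by
  rw [← not_lt, packVal_lt_iff, not_lt]

theorem packVal_congr {w : Fin n → α} {w' : Fin n → β} (h : ∀ i j, w i ≤ w j ↔ w' i ≤ w' j) :
    packVal w = packVal w' := by
  funext i
  rw [packVal_eq_card_image, packVal_eq_card_image]
  simp only [h]
  refine card_image_congr_of_factors _ _ _ fun i _ j _ => ?_
  rw [le_antisymm_iff, le_antisymm_iff, h, h]

theorem packedWord_le_maxLetter (u : PackedWord n) (i : Fin n) : u.1 i ≤ maxLetter u.1 :=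
  Finset.le_sup (f := u.1) (Finset.mem_univ i)

theorem packedWord_pos (u : PackedWord n) (i : Fin n) : 1 ≤ u.1 i := by
  have h : u.1 i ∈ Finset.univ.image u.1 := Finset.mem_image_of_mem _ (Finset.mem_univ i)
  rw [u.2] at h
  exact (Finset.mem_Icc.mp h).1

theorem packedWord_exists (u : PackedWord n) {k : ℕ} (h1 : 1 ≤ k) (h2 : k ≤ maxLetter u.1) :
    ∃ i, u.1 i = k := by
  have h : k ∈ Finset.univ.image u.1 := by
    rw [u.2]
    exact Finset.mem_Icc.mpr ⟨h1, h2⟩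
  obtain ⟨i, -, hi⟩ := Finset.mem_image.mp h
  exact ⟨i, hi⟩

/-- Here `r` sends a position to its block, numbered from `0`, and `s` picks a representative of
each block. Words constant on the blocks of `u` thereby become words indexed by blocks. -/
theorem packedWord_section (u : PackedWord n) :
    ∃ (r : Fin n → Fin (maxLetter u.1)) (s : Fin (maxLetter u.1) → Fin n),
      (∀ i, (r i : ℕ) + 1 = u.1 i) ∧ ∀ a, r (s a) = a := by
  have hpos := packedWord_pos u
  have hmax := packedWord_le_maxLetter u
  have hex : ∀ a : Fin (maxLetter u.1), ∃ i, u.1 i = (a : ℕ) + 1 := fun a =>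
    packedWord_exists u (by omega) a.2
  choose s hs using hex
  refine ⟨fun i => ⟨u.1 i - 1, by have := hpos i; have := hmax i; omega⟩, s, fun i => ?_,
    fun a => Fin.ext ?_⟩
  · have := hpos i
    simp only
    omega
  · simp only [hs]
    omega

theorem maxLetter_eq_card (u : PackedWord n) : maxLetter u.1 = (Finset.univ.image u.1).card := by
  rw [u.2, Nat.card_Icc, Nat.add_sub_cancel]

theorem packVal_packedWord (u : PackedWord n) : packVal u.1 = u.1 := by
  funext i
  unfold packVal
  rw [u.2]
  have : (Finset.Icc 1 (maxLetter u.1)).filter (fun a => a ≤ u.1 i) = Finset.Icc 1 (u.1 i) := by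
    ext a
    have := packedWord_le_maxLetter u i
    simp only [Finset.mem_filter, Finset.mem_Icc]
    omega
  rw [this, Nat.card_Icc, Nat.add_sub_cancel]

/-- A packed word is determined by the weak order it induces on positions. Later identities between
packed words are checked through this criterion. -/
theorem pack_eq_iff (w : Fin n → α) (u : PackedWord n) :
    pack w = u ↔ ∀ i j, w i ≤ w j ↔ u.1 i ≤ u.1 j := by
  constructor
  · rintro rfl i j
    exact (packVal_le_iff w i j).symm
  · intro h
    apply Subtype.ext
    rw [← packVal_packedWord u]
    exact packVal_congr h

theorem pack_le_iff (w : Fin n → α) (i j : Fin n) : (pack w).1 i ≤ (pack w).1 j ↔ w i ≤ w j :=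
  packVal_le_iff w i j

theorem pack_lt_iff (w : Fin n → α) (i j : Fin n) : (pack w).1 i < (pack w).1 j ↔ w i < w j :=
  packVal_lt_iff w i j

theorem pack_inj_iff (w : Fin n → α) (i j : Fin n) : (pack w).1 i = (pack w).1 j ↔ w i = w j := by
  rw [le_antisymm_iff, le_antisymm_iff, pack_le_iff, pack_le_iff]

theorem pack_eq_of_lt_of_eq (w : Fin n → α) (u : PackedWord n)
    (hlt : ∀ i j, u.1 i < u.1 j → w i < w j) (heq : ∀ i j, u.1 i = u.1 j → w i = w j) :
    pack w = u := by
  rw [pack_eq_iff]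
  intro i j
  rcases lt_trichotomy (u.1 i) (u.1 j) with h | h | h
  · exact ⟨fun _ => h.le, fun _ => (hlt i j h).le⟩
  · exact ⟨fun _ => h.le, fun _ => (heq i j h).le⟩
  · exact ⟨fun h' => absurd (hlt j i h) h'.not_gt, fun h' => absurd h h'.not_gt⟩

theorem maxLetter_pack (w : Fin n → α) : maxLetter (pack w).1 = (Finset.univ.image w).card := by
  rw [maxLetter_eq_card]
  exact card_image_congr_of_factors _ _ _ fun i _ j _ => (pack_inj_iff w i j).symm

theorem evaluation_length (u : PackedWord n) : (evaluation u).length = maxLetter u.1 := by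
  unfold evaluation
  exact List.length_ofFn

theorem mem_coarsenings (u v : PackedWord n) : v ∈ coarsenings u ↔ Refines v u := by
  simp [coarsenings]

theorem mem_weakWords (P : Fin n → Fin n → Prop) (u : PackedWord n) :
    u ∈ weakWords P ↔ ∀ i j, P i j → u.1 i ≤ u.1 j := by
  simp [weakWords]

theorem mem_strictWords (P : Fin n → Fin n → Prop) (u : PackedWord n) :
    u ∈ strictWords P ↔ ∀ i j, P i j → u.1 i < u.1 j := by
  simp [strictWords]

theorem pack_mem_weakWords (P : Fin n → Fin n → Prop) (w : Fin n → α) :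
    pack w ∈ weakWords P ↔ ∀ i j, P i j → w i ≤ w j := by
  simp [mem_weakWords, pack_le_iff]

theorem pack_mem_strictWords (P : Fin n → Fin n → Prop) (w : Fin n → α) :
    pack w ∈ strictWords P ↔ ∀ i j, P i j → w i < w j := by
  simp [mem_strictWords, pack_lt_iff]

/-! ### Basis elements and the expansion of `Γ_P` -/

theorem sum_M_apply (s : Finset (PackedWord n)) (u : PackedWord n) [Decidable (u ∈ s)] :
    (∑ v ∈ s, M v) u = if u ∈ s then 1 else 0 := by
  rw [Finsupp.finsetSum_apply]
  simp only [M, Finsupp.single_apply]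
  rw [Finset.sum_ite_eq' s u]
  split_ifs <;> rfl

theorem std_lt_iff {u : Fin n → ℕ} {i j : Fin n} (hij : i < j) :
    std u i < std u j ↔ u i ≤ u j := by
  have hmono : Monotone (u ∘ Tuple.sort u) := Tuple.monotone_sort u
  have hi : Tuple.sort u (std u i) = i := by simp [std]
  have hj : Tuple.sort u (std u j) = j := by simp [std]
  constructor
  · intro h
    have := hmono h.le
    simpa [hi, hj] using this
  · intro h
    by_contra hcon
    have hle : std u j ≤ std u i := not_lt.mp hcon
    have h1 := hmono hle
    simp only [Function.comp_apply, hi, hj] at h1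
    have heq : u i = u j := le_antisymm h h1
    have hne : std u j ≠ std u i := fun h => hij.ne' ((std u).injective h)
    have hlt : std u j < std u i := lt_of_le_of_ne hle hne
    -- Stability of the sort: equal letters keep their left-to-right order, which contradicts `i <
    -- j`.
    have h2 := (Tuple.eq_sort_iff (f := u) (σ := Tuple.sort u)).1 rfl
    have h3 := h2.2 _ _ hlt (by simp [hi, hj, heq])
    rw [hi, hj] at h3
    exact absurd h3 hij.not_gt

/-- By `std_lt_iff` and naturality, `u` is weakly `P`-increasing iff the inverse of its
standardization is a linear extension; distinct permutations have disjoint classes. -/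
theorem gamma_eq_sum_weakWords (P : Fin n → Fin n → Prop) (hnat : ∀ i j, P i j → i < j) :
    gamma P = ∑ u ∈ weakWords P, M u := by
  classical
  have h1 : gamma P = ∑ σ ∈ linearExtensions P, G σ⁻¹ := by
    unfold gamma gammaFQSym
    rw [map_sum]
    refine Finset.sum_congr rfl fun σ _ => ?_
    simp [embedFQSym, F]
  have h2 : (weakWords P) = (linearExtensions P).biUnion
      (fun σ => Finset.univ.filter (fun u : PackedWord n => std u.1 = σ⁻¹)) := by
    ext u
    simp only [mem_weakWords, Finset.mem_biUnion, linearExtensions, Finset.mem_filter,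
      Finset.mem_univ, true_and]
    constructor
    · intro h
      refine ⟨(std u.1)⁻¹, fun i j hij => ?_, by simp⟩
      rw [inv_inv]
      exact (std_lt_iff (hnat i j hij)).2 (h i j hij)
    · rintro ⟨σ, hσ, hu⟩ i j hij
      have := hσ i j hij
      rw [← hu] at this
      exact (std_lt_iff (hnat i j hij)).1 this
  rw [h1, h2, Finset.sum_biUnion]
  · rfl
  · intro σ _ τ _ hne
    rw [Function.onFun, Finset.disjoint_left]
    intro u hu hu'
    simp only [Finset.mem_filter, Finset.mem_univ, true_and] at hu hu'
    exact hne (inv_injective (hu.symm.trans hu'))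

/-! ### Signed sums over packed words -/

/-- The letter at position `a` occurs only once in `w`. -/
def IsAlone (w : PackedWord n) (a : Fin n) : Prop := ∀ j, w.1 j = w.1 a → j = a

/-- The last block of `w` is `{a}`. -/
def IsLastBlock (w : PackedWord n) (a : Fin n) : Prop :=
  IsAlone w a ∧ w.1 a = maxLetter w.1

open Classical in
/-- A word whose packing is `toggle w a`. -/
noncomputable def toggleWord (w : PackedWord n) (a : Fin n) (p : Fin n) : ℕ :=
  if p = a then (if IsAlone w a then 2 * w.1 a + 2 else 2 * w.1 a - 1) else 2 * w.1 p

/-- If `a` is alone in its block, merge this block with the next one; otherwise, split `{a}` off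
its block, just before the block. -/
noncomputable def toggle (w : PackedWord n) (a : Fin n) : PackedWord n := pack (toggleWord w a)

theorem toggleWord_of_ne (w : PackedWord n) {a p : Fin n} (h : p ≠ a) :
    toggleWord w a p = 2 * w.1 p := by
  simp [toggleWord, h]

theorem toggleWord_of_isAlone {w : PackedWord n} {a : Fin n} (h : IsAlone w a) :
    toggleWord w a a = 2 * w.1 a + 2 := by
  simp [toggleWord, h]

theorem toggleWord_of_not_isAlone {w : PackedWord n} {a : Fin n} (h : ¬ IsAlone w a) :
    toggleWord w a a = 2 * w.1 a - 1 := by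
  simp [toggleWord, h]

theorem exists_next_of_not_isLastBlock {w : PackedWord n} {a : Fin n} (h : IsAlone w a)
    (hl : ¬ IsLastBlock w a) : ∃ j, j ≠ a ∧ w.1 j = w.1 a + 1 := by
  have h1 : w.1 a ≠ maxLetter w.1 := fun h' => hl ⟨h, h'⟩
  have h2 := packedWord_le_maxLetter w a
  obtain ⟨j, hj⟩ := packedWord_exists w (k := w.1 a + 1) (by omega) (by omega)
  refine ⟨j, ?_, hj⟩
  rintro rfl
  omega

theorem exists_ne_of_not_isAlone {w : PackedWord n} {a : Fin n} (h : ¬ IsAlone w a) :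
    ∃ j, j ≠ a ∧ w.1 j = w.1 a := by
  unfold IsAlone at h
  push Not at h
  obtain ⟨j, h1, h2⟩ := h
  exact ⟨j, h2, h1⟩

theorem isAlone_toggle_iff {w : PackedWord n} {a : Fin n} (hl : ¬ IsLastBlock w a) :
    IsAlone (toggle w a) a ↔ ¬ IsAlone w a := by
  by_cases h : IsAlone w a
  · simp only [h, not_true_eq_false, iff_false]
    intro h'
    obtain ⟨j, hj, hj'⟩ := exists_next_of_not_isLastBlock h hl
    refine hj (h' j ?_)
    unfold toggle
    rw [pack_inj_iff, toggleWord_of_isAlone h, toggleWord_of_ne w hj, hj']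
    ring
  · simp only [h, not_false_eq_true, iff_true]
    intro j hj
    by_contra hne
    unfold toggle at hj
    rw [pack_inj_iff, toggleWord_of_not_isAlone h, toggleWord_of_ne w hne] at hj
    have := packedWord_pos w a
    omega

theorem not_isLastBlock_toggle {w : PackedWord n} {a : Fin n} (hl : ¬ IsLastBlock w a) :
    ¬ IsLastBlock (toggle w a) a := by
  rintro ⟨h1, h2⟩
  have h := (isAlone_toggle_iff hl).1 h1
  obtain ⟨j, hj, hj'⟩ := exists_ne_of_not_isAlone h
  have h3 : (toggle w a).1 a < (toggle w a).1 j := by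
    unfold toggle
    rw [pack_lt_iff, toggleWord_of_not_isAlone h, toggleWord_of_ne w hj, hj']
    have := packedWord_pos w a
    omega
  have h4 := packedWord_le_maxLetter (toggle w a) j
  omega

theorem toggle_le_iff_of_ne (w : PackedWord n) {a i j : Fin n} (hi : i ≠ a) (hj : j ≠ a) :
    (toggle w a).1 i ≤ (toggle w a).1 j ↔ w.1 i ≤ w.1 j := by
  unfold toggle
  rw [pack_le_iff, toggleWord_of_ne w hi, toggleWord_of_ne w hj]
  omega

/-- After a merge, `a` has company, and splitting puts it back just before the block it joined.
After a split, the next block is the one that `a` left, so merging restores it. -/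
theorem toggle_toggle {w : PackedWord n} {a : Fin n} (hl : ¬ IsLastBlock w a) :
    toggle (toggle w a) a = w := by
  have hpos := packedWord_pos w a
  have hpos' := packedWord_pos (toggle w a) a
  have hle : ∀ i j, (toggle w a).1 i ≤ (toggle w a).1 j ↔ toggleWord w a i ≤ toggleWord w a j :=
    fun i j => pack_le_iff _ i j
  have hal := isAlone_toggle_iff hl
  conv_lhs => rw [toggle]
  rw [pack_eq_iff]
  intro i j
  by_cases h : IsAlone w a
  · have h' : ¬ IsAlone (toggle w a) a := fun h' => hal.1 h' h
    have hne : ∀ k, k ≠ a → w.1 k ≠ w.1 a := fun k hk hk' => hk (h k hk')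
    by_cases hi : i = a <;> by_cases hj : j = a
    · simp [hi, hj]
    · subst hi
      have := hle i j
      rw [toggleWord_of_isAlone h, toggleWord_of_ne w hj] at this
      rw [toggleWord_of_not_isAlone h', toggleWord_of_ne _ hj]
      have := hne j hj
      omega
    · subst hj
      have := hle j i
      rw [toggleWord_of_isAlone h, toggleWord_of_ne w hi] at this
      rw [toggleWord_of_not_isAlone h', toggleWord_of_ne _ hi]
      have := hne i hi
      omega
    · rw [toggleWord_of_ne _ hi, toggleWord_of_ne _ hj]
      have := toggle_le_iff_of_ne w hi hj
      omega
  · have h' : IsAlone (toggle w a) a := hal.2 h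
    by_cases hi : i = a <;> by_cases hj : j = a
    · simp [hi, hj]
    · subst hi
      have := hle j i
      rw [toggleWord_of_not_isAlone h, toggleWord_of_ne w hj] at this
      rw [toggleWord_of_isAlone h', toggleWord_of_ne _ hj]
      omega
    · subst hj
      rw [toggleWord_of_isAlone h', toggleWord_of_ne _ hi]
      obtain ⟨k, hk, hk'⟩ := exists_ne_of_not_isAlone h
      have h1 := hle k j
      rw [toggleWord_of_not_isAlone h, toggleWord_of_ne w hk] at h1
      have h2 := toggle_le_iff_of_ne w hi hk
      -- The block of `k`, from which `j` was split off, comes immediately after `{j}`: no doubled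
      -- letter fits between `2 * w.1 j - 1` and `2 * w.1 j`.
      have h3 : (toggle w j).1 k ≤ (toggle w j).1 j + 1 := by
        by_contra hcon
        have h4 := packedWord_le_maxLetter (toggle w j) k
        obtain ⟨p, hp⟩ := packedWord_exists (toggle w j) (k := (toggle w j).1 j + 1) (by omega)
          (by omega)
        have hpj : p ≠ j := by
          rintro rfl
          omega
        have h5 := toggle_le_iff_of_ne w hk hpj
        have h6 := hle p j
        rw [toggleWord_of_not_isAlone h, toggleWord_of_ne w hpj] at h6
        omega
      omega
    · rw [toggleWord_of_ne _ hi, toggleWord_of_ne _ hj]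
      have := toggle_le_iff_of_ne w hi hj
      omega

open Classical in
theorem maxLetter_eq_card_erase (w : PackedWord n) (a : Fin n) :
    maxLetter w.1 = ((Finset.univ.erase a).image w.1).card + if IsAlone w a then 1 else 0 := by
  have h0 : Finset.univ.image w.1 = insert (w.1 a) ((Finset.univ.erase a).image w.1) := by
    rw [← Finset.image_insert, Finset.insert_erase (Finset.mem_univ a)]
  rw [maxLetter_eq_card, h0]
  by_cases h : IsAlone w a
  · rw [Finset.card_insert_of_notMem, if_pos h]
    intro hmem
    obtain ⟨j, hj, hj'⟩ := Finset.mem_image.mp hmem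
    exact (Finset.mem_erase.mp hj).1 (h j hj')
  · rw [Finset.insert_eq_of_mem, if_neg h, add_zero]
    obtain ⟨j, hj, hj'⟩ := exists_ne_of_not_isAlone h
    exact Finset.mem_image.mpr ⟨j, Finset.mem_erase.mpr ⟨hj, Finset.mem_univ j⟩, hj'⟩

/-- The relative order of the positions other than `a` does not change, so the number of blocks
changes only through whether `a` has a block of its own. -/
theorem sign_toggle {w : PackedWord n} {a : Fin n} (hl : ¬ IsLastBlock w a) :
    (-1 : ℚ) ^ maxLetter w.1 + (-1 : ℚ) ^ maxLetter (toggle w a).1 = 0 := by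
  have hcard : ((Finset.univ.erase a).image (toggle w a).1).card
      = ((Finset.univ.erase a).image w.1).card :=
    card_image_congr_of_factors _ _ _ fun i hi j hj => by
      have hi' := (Finset.mem_erase.mp hi).1
      have hj' := (Finset.mem_erase.mp hj).1
      rw [le_antisymm_iff, le_antisymm_iff, toggle_le_iff_of_ne w hi' hj',
        toggle_le_iff_of_ne w hj' hi']
  rw [maxLetter_eq_card_erase w a, maxLetter_eq_card_erase (toggle w a) a, hcard]
  have hal := isAlone_toggle_iff hl
  by_cases h : IsAlone w a
  · have h' : ¬ IsAlone (toggle w a) a := fun h' => hal.1 h' h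
    simp [h, h', pow_succ]
  · have h' : IsAlone (toggle w a) a := hal.2 h
    simp [h, h', pow_succ]

open Classical in
-- Toggling at `a` is a sign-reversing involution without fixed points away from the words ending in
-- the block `{a}`, where there is no next block to merge with.
theorem sum_sign_eq_sum_isLastBlock (S : Finset (PackedWord n)) (a : Fin n)
    (hS : ∀ w ∈ S, ¬ IsLastBlock w a → toggle w a ∈ S) :
    ∑ w ∈ S, (-1 : ℚ) ^ maxLetter w.1
      = ∑ w ∈ S.filter (fun w => IsLastBlock w a), (-1 : ℚ) ^ maxLetter w.1 := by
  rw [← Finset.sum_filter_add_sum_filter_not S (fun w => IsLastBlock w a), add_eq_left]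
  refine Finset.sum_involution (fun w _ => toggle w a) ?_ ?_ ?_ ?_
  · intro w hw
    exact sign_toggle (Finset.mem_filter.mp hw).2
  · intro w hw _ heq
    have hl := (Finset.mem_filter.mp hw).2
    have := isAlone_toggle_iff hl
    rw [heq] at this
    tauto
  · intro w hw
    obtain ⟨h1, h2⟩ := Finset.mem_filter.mp hw
    exact Finset.mem_filter.mpr ⟨hS w h1 h2, not_isLastBlock_toggle h2⟩
  · intro w hw
    exact toggle_toggle (Finset.mem_filter.mp hw).2

theorem sum_sign_weakWords {P : Fin n → Fin n → Prop} (hnat : ∀ i j, P i j → i < j)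
    (hne : ∃ i j, P i j) : ∑ w ∈ weakWords P, (-1 : ℚ) ^ maxLetter w.1 = 0 := by
  classical
  -- The least position lying below another one lies above none. The constraints on `a` are then
  -- only upper bounds `w a ≤ w j`, which toggling respects, and `w a ≤ w b` forbids `{a}` as last
  -- block, so nothing survives.
  obtain ⟨a, ⟨b, hab⟩, hmin⟩ := WellFounded.has_min (wellFounded_lt (α := Fin n))
    {i | ∃ j, P i j} hne
  rw [sum_sign_eq_sum_isLastBlock _ a]
  · refine Finset.sum_eq_zero fun w hw => ?_
    obtain ⟨h1, h2, h3⟩ := Finset.mem_filter.mp hw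
    rw [mem_weakWords] at h1
    have h4 := h1 a b hab
    have h5 := packedWord_le_maxLetter w b
    exact absurd (h2 b (by omega)) (hnat a b hab).ne'
  · intro w hw hl
    rw [mem_weakWords] at hw
    unfold toggle
    rw [pack_mem_weakWords]
    intro i j hij
    have hja : j ≠ a := by
      rintro rfl
      exact hmin i ⟨j, hij⟩ (hnat i j hij)
    rw [toggleWord_of_ne w hja]
    have h1 := hw i j hij
    by_cases hia : i = a
    · subst hia
      by_cases h : IsAlone w i
      · rw [toggleWord_of_isAlone h]
        have : w.1 j ≠ w.1 i := fun h' => hja (h j h')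
        omega
      · rw [toggleWord_of_not_isAlone h]
        omega
    · rw [toggleWord_of_ne w hia]
      omega

theorem card_image_snoc {w : Fin (n + 1) → ℕ} (h : ∀ i : Fin n, w i.castSucc ≠ w (Fin.last n)) :
    (Finset.univ.image w).card = (Finset.univ.image (fun i : Fin n => w i.castSucc)).card + 1 := by
  have h0 : Finset.univ.image w
      = insert (w (Fin.last n)) (Finset.univ.image (fun i : Fin n => w i.castSucc)) := by
    ext k
    simp only [Finset.mem_image, Finset.mem_univ, true_and, Finset.mem_insert]
    rw [Fin.exists_fin_succ']
    tauto
  rw [h0, Finset.card_insert_of_notMem]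
  simpa using h

/-- The last position lies below no other, so its constraints are strict lower bounds, preserved by
merging upwards and by splitting just before its block. The surviving words end in the block of that
position alone; deleting it loses one block and one position, and induction applies. -/
theorem sum_sign_strictWords : ∀ {n : ℕ} {P : Fin n → Fin n → Prop}, (∀ i j, P i j → i < j) →
    ∑ w ∈ strictWords P, (-1 : ℚ) ^ maxLetter w.1 = (-1) ^ n := by
  classical
  intro n
  induction n with
  | zero =>
    intro P _
    have h : strictWords P = {pack (Fin.elim0 : Fin 0 → ℕ)} := by
      ext w
      rw [mem_strictWords, Finset.mem_singleton]
      refine ⟨fun _ => Subtype.ext (funext fun i => i.elim0), fun _ i => i.elim0⟩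
    rw [h, Finset.sum_singleton, maxLetter_pack]
    simp
  | succ n ih =>
    intro P hnat
    rw [sum_sign_eq_sum_isLastBlock _ (Fin.last n)]
    · have hlast : ∀ w : PackedWord (n + 1), IsLastBlock w (Fin.last n) →
          ∀ i : Fin n, w.1 i.castSucc < w.1 (Fin.last n) := by
        intro w h i
        have h1 := packedWord_le_maxLetter w i.castSucc
        refine lt_of_le_of_ne (by rw [h.2]; exact h1) fun h' => ?_
        exact (Fin.castSucc_lt_last i).ne (h.1 _ h')
      have hP := ih (P := fun i j => P i.castSucc j.castSucc)
        (fun i j hij => Fin.castSucc_lt_castSucc_iff.1 (hnat _ _ hij))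
      rw [pow_succ, ← hP, Finset.sum_mul]
      refine Finset.sum_nbij' (fun w => pack (fun i : Fin n => w.1 i.castSucc))
        (fun v => pack (Fin.snoc v.1 (maxLetter v.1 + 1) : Fin (n + 1) → ℕ)) ?_ ?_ ?_ ?_ ?_
      · intro w hw
        obtain ⟨h1, -⟩ := Finset.mem_filter.mp hw
        rw [mem_strictWords] at h1
        rw [pack_mem_strictWords]
        exact fun i j hij => h1 _ _ hij
      · intro v hv
        rw [mem_strictWords] at hv
        have hb := packedWord_le_maxLetter v
        refine Finset.mem_filter.mpr ⟨?_, ?_, ?_⟩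
        · rw [pack_mem_strictWords]
          intro i j hij
          have hij' := hnat i j hij
          induction j using Fin.lastCases with
          | last =>
            induction i using Fin.lastCases with
            | last => exact absurd hij' (lt_irrefl _)
            | cast i => simp only [Fin.snoc_castSucc, Fin.snoc_last]; have := hb i; omega
          | cast j =>
            induction i using Fin.lastCases with
            | last => exact absurd hij' (Fin.castSucc_lt_last j).not_gt
            | cast i => simp only [Fin.snoc_castSucc]; exact hv i j hij
        · intro j hj
          rw [pack_inj_iff] at hj
          induction j using Fin.lastCases with
          | last => rfl
          | cast j =>
            simp only [Fin.snoc_castSucc, Fin.snoc_last] at hj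
            have := hb j
            omega
        · apply le_antisymm (packedWord_le_maxLetter _ _)
          refine Finset.sup_le fun j _ => ?_
          rw [pack_le_iff]
          induction j using Fin.lastCases with
          | last => rfl
          | cast j =>
            simp only [Fin.snoc_castSucc, Fin.snoc_last]
            have := hb j
            omega
      · intro w hw
        have hl := hlast w (Finset.mem_filter.mp hw).2
        have hb := packedWord_le_maxLetter (pack (fun i : Fin n => w.1 i.castSucc))
        rw [pack_eq_iff]
        intro i j
        induction j using Fin.lastCases with
        | last =>
          induction i using Fin.lastCases with
          | last => simp
          | cast i =>
            simp only [Fin.snoc_castSucc, Fin.snoc_last]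
            have := hb i
            have := hl i
            omega
        | cast j =>
          induction i using Fin.lastCases with
          | last =>
            simp only [Fin.snoc_castSucc, Fin.snoc_last]
            have := hb j
            have := hl j
            omega
          | cast i =>
            simp only [Fin.snoc_castSucc]
            exact pack_le_iff _ i j
      · intro v _
        rw [pack_eq_iff]
        intro i j
        rw [pack_le_iff]
        simp only [Fin.snoc_castSucc]
      · intro w hw
        have hl := hlast w (Finset.mem_filter.mp hw).2
        rw [maxLetter_pack, maxLetter_eq_card, card_image_snoc fun i => (hl i).ne, pow_succ]
    · intro w hw hl
      rw [mem_strictWords] at hw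
      unfold toggle
      rw [pack_mem_strictWords]
      intro i j hij
      have h1 := hw i j hij
      have hil : i ≠ Fin.last n := by
        rintro rfl
        exact absurd (hnat _ _ hij) (Fin.le_last j).not_gt
      rw [toggleWord_of_ne w hil]
      by_cases hjl : j = Fin.last n
      · subst hjl
        by_cases h : IsAlone w (Fin.last n)
        · rw [toggleWord_of_isAlone h]
          omega
        · rw [toggleWord_of_not_isAlone h]
          omega
      · rw [toggleWord_of_ne w hjl]
        omega

/-! ### Change of sign of the alphabet -/

theorem sigmaNegCoeff_eq (w : PackedWord n) : sigmaNegCoeff w = (-1) ^ maxLetter w.1 := by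
  simp [sigmaNegCoeff, SymSeries.lambdaNeg, evaluation_length]

theorem refines_of_internalProduct_eq {u v w : PackedWord n} (h : internalProduct v w = u) :
    Refines v u := by
  intro i j hij
  have := ((pack_eq_iff _ u).1 h i j).2 hij
  rw [Prod.Lex.toLex_le_toLex] at this
  rcases this with h | h
  · exact h.le
  · exact h.1.le

/-- Such a `w` is constant on the blocks of `u`, and must increase strictly along those blocks of
`u` that `v` merges; between different blocks of `v` it is free. So this is a signed count of strict
words on the blocks of `u`. -/
theorem sum_sign_internalProduct {u v : PackedWord n} (hvu : Refines v u) :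
    ∑ w ∈ Finset.univ.filter (fun w => internalProduct v w = u), (-1 : ℚ) ^ maxLetter w.1
      = (-1) ^ maxLetter u.1 := by
  classical
  obtain ⟨r, s, hr1, hrs⟩ := packedWord_section u
  have hus : ∀ i, u.1 (s (r i)) = u.1 i := fun i => by rw [← hr1, hrs, hr1]
  have hs : ∀ a, u.1 (s a) = (a : ℕ) + 1 := fun a => by rw [← hr1, hrs]
  have hvs : ∀ i, v.1 (s (r i)) = v.1 i := fun i =>
    le_antisymm (hvu _ _ (hus i).le) (hvu _ _ (hus i).ge)
  have hr : ∀ i j, r i < r j ↔ u.1 i < u.1 j := fun i j => by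
    have := hr1 i
    have := hr1 j
    rw [Fin.lt_def]
    omega
  have hws : ∀ w : PackedWord n, internalProduct v w = u → ∀ i, w.1 (s (r i)) = w.1 i := by
    intro w hw i
    have h1 := ((pack_eq_iff _ u).1 hw (s (r i)) i).2 (hus i).le
    have h2 := ((pack_eq_iff _ u).1 hw i (s (r i))).2 (hus i).ge
    have h3 := toLex.injective (le_antisymm h1 h2)
    exact (Prod.ext_iff.1 h3).2
  rw [← sum_sign_strictWords (P := fun a b : Fin (maxLetter u.1) => a < b ∧ v.1 (s a) = v.1 (s b))
    (fun _ _ h => h.1)]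
  refine Finset.sum_nbij' (fun w => pack (fun a => w.1 (s a))) (fun w' => pack (fun i => w'.1 (r i)))
    ?_ ?_ ?_ ?_ ?_
  · intro w hw
    have hw' := (Finset.mem_filter.mp hw).2
    rw [pack_mem_strictWords]
    rintro a b ⟨hab, hv⟩
    have h1 := (pack_eq_iff _ u).1 hw' (s b) (s a)
    rw [hs, hs, Prod.Lex.toLex_le_toLex] at h1
    have hab' : (a : ℕ) < b := hab
    by_contra hcon
    have := h1.1 (Or.inr ⟨hv.symm, not_lt.mp hcon⟩)
    omega
  · intro w' hw'
    rw [mem_strictWords] at hw'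
    refine Finset.mem_filter.mpr ⟨Finset.mem_univ _, pack_eq_of_lt_of_eq _ _ ?_ ?_⟩
    · intro i j hij
      rw [Prod.Lex.toLex_lt_toLex]
      rcases (hvu i j hij.le).lt_or_eq with h | h
      · exact Or.inl h
      · refine Or.inr ⟨h, ?_⟩
        simp only [pack_lt_iff]
        exact hw' _ _ ⟨(hr i j).2 hij, by rw [hvs, hvs]; exact h⟩
    · intro i j hij
      have h1 : v.1 i = v.1 j := le_antisymm (hvu _ _ hij.le) (hvu _ _ hij.ge)
      have h2 : r i = r j := Fin.ext (by have := hr1 i; have := hr1 j; omega)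
      rw [h1, (pack_inj_iff (fun i => w'.1 (r i)) i j).2 (by rw [h2])]
  · intro w hw
    have h := hws w (Finset.mem_filter.mp hw).2
    rw [pack_eq_iff]
    intro i j
    rw [pack_le_iff, h, h]
  · intro w' _
    rw [pack_eq_iff]
    intro a b
    rw [pack_le_iff, hrs, hrs]
  · intro w hw
    have h := hws w (Finset.mem_filter.mp hw).2
    rw [maxLetter_pack, maxLetter_eq_card]
    congr 2
    ext c
    simp only [Finset.mem_image, Finset.mem_univ, true_and]
    exact ⟨fun ⟨i, hi⟩ => ⟨r i, by rw [h, hi]⟩, fun ⟨a, ha⟩ => ⟨s a, ha⟩⟩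

theorem negAlphabet_M_apply (u v : PackedWord n) :
    negAlphabet (M u) v
      = ∑ w ∈ Finset.univ.filter (fun w => internalProduct v w = u), (-1 : ℚ) ^ maxLetter w.1 := by
  classical
  simp only [negAlphabet, M, Finsupp.lift_apply, zero_smul, Finsupp.sum_single_index, one_smul,
    Finsupp.finsetSum_apply, Finsupp.smul_apply, Finsupp.single_apply, smul_eq_mul, mul_ite,
    mul_one, mul_zero, Finset.sum_ite_eq', Finset.mem_univ, if_true, sigmaNegCoeff_eq]

theorem negAlphabet_M (u : PackedWord n) :
    negAlphabet (M u) = (-1 : ℚ) ^ maxLetter u.1 • ∑ v ∈ coarsenings u, M v := by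
  classical
  ext v
  rw [negAlphabet_M_apply, Finsupp.smul_apply, sum_M_apply, smul_eq_mul]
  split_ifs with h
  · rw [mem_coarsenings] at h
    rw [sum_sign_internalProduct h, mul_one]
  · rw [mem_coarsenings] at h
    rw [mul_zero]
    refine Finset.sum_eq_zero fun w hw => ?_
    exact absurd (refines_of_internalProduct_eq (Finset.mem_filter.mp hw).2) h

theorem neg_one_pow_smul_negAlphabet_weakWords {P : Fin n → Fin n → Prop}
    (hnat : ∀ i j, P i j → i < j) :
    (-1 : ℚ) ^ n • negAlphabet (∑ u ∈ weakWords P, M u) = ∑ v ∈ strictWords P, M v := by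
  classical
  ext v
  rw [map_sum, Finsupp.smul_apply, Finsupp.finsetSum_apply, sum_M_apply, smul_eq_mul]
  simp only [negAlphabet_M_apply]
  -- The sums over the fibres of `w ↦ pack(v, w)` combine into one sum over all `w` with `pack(v,
  -- w)` in `C(P)`.
  rw [Finset.sum_fiberwise_eq_sum_filter]
  have hmem : ∀ w, internalProduct v w ∈ weakWords P ↔
      ∀ i j, P i j → v.1 i < v.1 j ∨ v.1 i = v.1 j ∧ w.1 i ≤ w.1 j := by
    intro w
    unfold internalProduct
    simp only [pack_mem_weakWords, Prod.Lex.toLex_le_toLex]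
  have hsq : (-1 : ℚ) ^ n * (-1) ^ n = 1 := by
    rw [← mul_pow]
    simp
  split_ifs with hv
  · rw [mem_strictWords] at hv
    -- The first components already decide every comparison, so `w` ranges over all packed words,
    -- that is, the strict words of the empty relation.
    have : Finset.univ.filter (fun w => internalProduct v w ∈ weakWords P)
        = strictWords (fun _ _ : Fin n => False) := by
      ext w
      simp only [Finset.mem_filter, Finset.mem_univ, true_and, hmem, mem_strictWords,
        false_imp_iff, implies_true, iff_true]
      exact fun i j hij => Or.inl (hv i j hij)
    rw [this, sum_sign_strictWords (by simp), hsq]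
  · rw [mul_eq_zero]
    right
    rw [mem_strictWords] at hv
    push Not at hv
    obtain ⟨a, b, hab, hv⟩ := hv
    by_cases hw : v ∈ weakWords P
    · rw [mem_weakWords] at hw
      -- Only the ties of `v` along `P` constrain `w`, and the pair `(a, b)` is such a tie.
      rw [← sum_sign_weakWords (P := fun i j => P i j ∧ v.1 i = v.1 j) (fun i j h => hnat i j h.1)
        ⟨a, b, hab, le_antisymm (hw a b hab) hv⟩]
      refine Finset.sum_congr ?_ fun _ _ => rfl
      ext w
      simp only [Finset.mem_filter, Finset.mem_univ, true_and, hmem, mem_weakWords]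
      constructor
      · rintro h i j ⟨hij, he⟩
        rcases h i j hij with h | h
        · exact absurd he h.ne
        · exact h.2
      · intro h i j hij
        rcases (hw i j hij).lt_or_eq with h' | h'
        · exact Or.inl h'
        · exact Or.inr ⟨h', h i j ⟨hij, h'⟩⟩
    · refine Finset.sum_eq_zero fun w h => ?_
      rw [Finset.mem_filter, hmem] at h
      refine absurd ((mem_weakWords P v).2 fun i j hij => ?_) hw
      rcases h.2 i j hij with h | h
      · exact h.le
      · exact h.1.le

theorem neg_one_pow_smul_negAlphabet_gamma {P : Fin n → Fin n → Prop}
    (hnat : ∀ i j, P i j → i < j) :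
    (-1 : ℚ) ^ n • negAlphabet (gamma P) = ∑ v ∈ strictWords P, M v := by
  rw [gamma_eq_sum_weakWords P hnat, neg_one_pow_smul_negAlphabet_weakWords hnat]

/-! ### Realizations over alphabets and integer points -/

theorem mem_smul_orderPolytope {P : Fin n → Fin n → Prop} {m : ℕ} {x : Fin n → ℝ} :
    x ∈ (m : ℝ) • orderPolytope P ↔
      (∀ i, 0 ≤ x i ∧ x i ≤ m) ∧ ∀ i j, P i j → x i ≤ x j := by
  have hm : (0 : ℝ) ≤ m := Nat.cast_nonneg m
  rw [Set.mem_smul_set]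
  constructor
  · rintro ⟨y, ⟨h1, h2⟩, rfl⟩
    refine ⟨fun i => ⟨mul_nonneg hm (h1 i).1, ?_⟩, fun i j hij =>
      mul_le_mul_of_nonneg_left (h2 i j hij) hm⟩
    simpa using mul_le_mul_of_nonneg_left (h1 i).2 hm
  · rintro ⟨h1, h2⟩
    rcases hm.eq_or_lt with h0 | h0
    -- For `m = 0` one cannot divide by `m`; the inequalities force `x = 0`, the image of the
    -- origin.
    · refine ⟨0, ⟨fun i => by simp, fun i j _ => le_rfl⟩, ?_⟩
      funext i
      have := h1 i
      rw [← h0] at this ⊢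
      simp [le_antisymm this.2 this.1]
    · refine ⟨fun i => x i / m, ⟨fun i => ⟨div_nonneg (h1 i).1 hm, ?_⟩, fun i j hij =>
        div_le_div_of_nonneg_right (h2 i j hij) hm⟩, ?_⟩
      · rw [div_le_one h0]
        exact (h1 i).2
      · funext i
        simp only [Pi.smul_apply, smul_eq_mul]
        field_simp

/-- The functional `x ↦ x j - x i` is surjective as `i ≠ j`, hence open, so taking interiors
commutes with its preimage. -/
theorem interior_setOf_apply_le {i j : Fin n} (hij : i ≠ j) :
    interior {x : Fin n → ℝ | x i ≤ x j} = {x | x i < x j} := by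
  let f : (Fin n → ℝ) →L[ℝ] ℝ :=
    ContinuousLinearMap.proj (R := ℝ) (φ := fun _ : Fin n => ℝ) j - ContinuousLinearMap.proj i
  have hf : Function.Surjective f := fun c => ⟨Pi.single j c, by simp [f, hij]⟩
  have h1 : {x : Fin n → ℝ | x i ≤ x j} = f ⁻¹' Set.Ici 0 := by
    ext x
    simp [f]
  rw [h1, ← (f.isOpenMap hf).preimage_interior_eq_interior_preimage f.continuous, interior_Ici]
  ext x
  simp [f]

theorem interior_setOf_forall {κ : Type*} [Finite κ] (S : κ → Set (Fin n → ℝ)) :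
    interior {x | ∀ k, x ∈ S k} = {x | ∀ k, x ∈ interior (S k)} := by
  rw [Set.ofPred_forall, Set.ofPred_forall]
  exact interior_iInter_of_finite _

theorem interior_setOf_apply_mem (i : Fin n) (s : Set ℝ) :
    interior {x : Fin n → ℝ | x i ∈ s} = {x | x i ∈ interior s} :=
  ((isOpenMap_eval (X := fun _ : Fin n => ℝ) i).preimage_interior_eq_interior_preimage
    (continuous_apply i) s).symm

theorem interior_setOf_order {P : Fin n → Fin n → Prop} (hnat : ∀ i j, P i j → i < j) :
    interior {x : Fin n → ℝ | ∀ i j, P i j → x i ≤ x j} = {x | ∀ i j, P i j → x i < x j} := by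
  have h1 : {x : Fin n → ℝ | ∀ i j, P i j → x i ≤ x j}
      = {x | ∀ k : {k : Fin n × Fin n // P k.1 k.2}, x ∈ {x : Fin n → ℝ | x k.1.1 ≤ x k.1.2}} := by
    ext x
    exact ⟨fun h k => h _ _ k.2, fun h i j hij => h ⟨(i, j), hij⟩⟩
  rw [h1, interior_setOf_forall]
  ext x
  have h2 : ∀ k : {k : Fin n × Fin n // P k.1 k.2},
      x ∈ interior {x : Fin n → ℝ | x k.1.1 ≤ x k.1.2} ↔ x k.1.1 < x k.1.2 := fun k => by
    rw [interior_setOf_apply_le (hnat _ _ k.2).ne]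
    rfl
  exact ⟨fun h i j hij => (h2 ⟨(i, j), hij⟩).1 (h ⟨(i, j), hij⟩),
    fun h k => (h2 k).2 (h _ _ k.2)⟩

theorem interior_cone {P : Fin n → Fin n → Prop} (hnat : ∀ i j, P i j → i < j) :
    interior (cone P) = {x | (∀ i, 0 < x i) ∧ ∀ i j, P i j → x i < x j} := by
  have h1 : cone P = {x | ∀ i, x ∈ {x : Fin n → ℝ | x i ∈ Set.Ici 0}} ∩
      {x : Fin n → ℝ | ∀ i j, P i j → x i ≤ x j} := rfl
  rw [h1, interior_inter, interior_setOf_order hnat, interior_setOf_forall]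
  simp only [interior_setOf_apply_mem, interior_Ici]
  rfl

theorem interior_smul_orderPolytope {P : Fin n → Fin n → Prop} (hnat : ∀ i j, P i j → i < j)
    (m : ℕ) : interior ((m : ℝ) • orderPolytope P) =
      {x | (∀ i, 0 < x i ∧ x i < (m : ℝ)) ∧ ∀ i j, P i j → x i < x j} := by
  have h1 : (m : ℝ) • orderPolytope P = {x | ∀ i, x ∈ {x : Fin n → ℝ | x i ∈ Set.Icc 0 (m : ℝ)}} ∩
      {x : Fin n → ℝ | ∀ i j, P i j → x i ≤ x j} := by
    ext x
    exact mem_smul_orderPolytope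
  rw [h1, interior_inter, interior_setOf_order hnat, interior_setOf_forall]
  simp only [interior_setOf_apply_mem, interior_Icc]
  rfl

theorem mem_integerPoints_cone {P : Fin n → Fin n → Prop} {z : Fin n → ℤ} :
    z ∈ integerPoints (cone P) ↔ (∀ i, z i ∈ Set.Ici 0) ∧ ∀ i j, P i j → z i ≤ z j := by
  simp [integerPoints, cone]

theorem mem_integerPoints_smul {P : Fin n → Fin n → Prop} {m : ℕ} {z : Fin n → ℤ} :
    z ∈ integerPoints ((m : ℝ) • orderPolytope P) ↔
      (∀ i, z i ∈ Set.Icc 0 (m : ℤ)) ∧ ∀ i j, P i j → z i ≤ z j := by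
  unfold integerPoints
  rw [Set.mem_ofPred_eq, mem_smul_orderPolytope]
  simp only [Set.mem_Icc]
  norm_cast

theorem mem_integerPoints_interior_cone {P : Fin n → Fin n → Prop}
    (hnat : ∀ i j, P i j → i < j) {z : Fin n → ℤ} :
    z ∈ integerPoints (interior (cone P)) ↔
      (∀ i, z i ∈ Set.Ici 1) ∧ ∀ i j, P i j → z i < z j := by
  unfold integerPoints
  rw [interior_cone hnat]
  simp only [Set.mem_ofPred_eq, Set.mem_Ici]
  norm_cast

theorem mem_integerPoints_interior_smul {P : Fin n → Fin n → Prop}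
    (hnat : ∀ i j, P i j → i < j) {m : ℕ} {z : Fin n → ℤ} :
    z ∈ integerPoints (interior ((m : ℝ) • orderPolytope P)) ↔
      (∀ i, z i ∈ Set.Icc 1 ((m : ℤ) - 1)) ∧ ∀ i j, P i j → z i < z j := by
  unfold integerPoints
  rw [interior_smul_orderPolytope hnat]
  simp only [Set.mem_ofPred_eq, Set.mem_Icc, Int.le_sub_one_iff]
  norm_cast

theorem onAlphabet_smul (S : Set ℤ) (c : ℚ) (f : WQSym n) :
    onAlphabet S (c • f) = c • onAlphabet S f := by
  classical
  funext w
  simp [onAlphabet]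

theorem onAlphabet_sum {ι : Type*} (S : Set ℤ) (s : Finset ι) (f : ι → WQSym n) :
    onAlphabet S (∑ i ∈ s, f i) = ∑ i ∈ s, onAlphabet S (f i) := by
  classical
  funext w
  rw [Finset.sum_apply]
  simp only [onAlphabet, Finsupp.finsetSum_apply]
  split_ifs <;> simp

theorem onAlphabet_sum_M (S : Set ℤ) (T : Finset (PackedWord n)) (X : Set (Fin n → ℤ))
    (h : ∀ z, z ∈ X ↔ (∀ i, z i ∈ S) ∧ pack z ∈ T) :
    onAlphabet S (∑ u ∈ T, M u) = sumOfWords X := by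
  classical
  funext w
  unfold onAlphabet sumOfWords
  rw [sum_M_apply, Set.indicator_apply, Pi.one_apply]
  by_cases h1 : ∀ i, w i ∈ S <;> by_cases h2 : pack w ∈ T <;> simp [h w, h1, h2]

/-! ### Products of series in noncommutative symmetric functions -/

namespace SymSeries

variable {R : Type*} [CommRing R]

theorem mul_nil (f g : SymSeries R) : mul f g [] = f [] * g [] := by
  simp [mul]

theorem mul_cons (f g : SymSeries R) (a : ℕ+) (I : List ℕ+) :
    mul f g (a :: I) = mul (fun J => f (a :: J)) g I + f [] * g (a :: I) := by
  simp [mul, Finset.sum_range_succ']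

theorem add_mul' (f g h : SymSeries R) (I : List ℕ+) :
    mul (fun J => f J + g J) h I = mul f h I + mul g h I := by
  simp [mul, add_mul, Finset.sum_add_distrib]

theorem const_mul' (c : R) (f g : SymSeries R) (I : List ℕ+) :
    mul (fun J => c * f J) g I = c * mul f g I := by
  simp [mul, mul_assoc, Finset.mul_sum]

theorem mul_assoc' (f g h : SymSeries R) : mul (mul f g) h = mul f (mul g h) := by
  funext I
  induction I generalizing f with
  | nil => simp only [mul_nil, mul_assoc]
  | cons a I ih =>
    simp only [mul_cons, mul_nil, add_mul', const_mul', ih]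
    ring

theorem one_mul' (f : SymSeries R) : mul one f = f := by
  funext I
  unfold mul
  rw [Finset.sum_eq_single 0]
  · simp [one]
  · intro k hk hk0
    rw [Finset.mem_range] at hk
    have : I.take k ≠ [] := by
      intro h
      rw [List.take_eq_nil_iff] at h
      rcases h with h | h
      · exact hk0 h
      · subst h
        simp at hk
        omega
    simp [one, this]
  · simp

theorem mul_one' (f : SymSeries R) : mul f one = f := by
  funext I
  unfold mul
  rw [Finset.sum_range_succ, Finset.sum_eq_zero]
  · simp [one]
  · intro k hk
    rw [Finset.mem_range] at hk
    have : I.drop k ≠ [] := by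
      intro h
      rw [List.drop_eq_nil_iff] at h
      omega
    simp [one, this]

theorem sigma_mul_cons (y : R) (f : SymSeries R) (a : ℕ+) (I : List ℕ+) :
    mul (sigma y) f (a :: I) = f (a :: I) + y ^ (a : ℕ) * f I := by
  have h : (fun J => sigma y (a :: J)) = fun J => y ^ (a : ℕ) * (one : SymSeries R) J := by
    funext J
    rcases J with _ | ⟨b, J⟩ <;> simp [sigma, one]
  rw [mul_cons, h, const_mul', one_mul']
  simp [sigma, add_comm]

theorem mul_sigma_concat (y : R) (f : SymSeries R) (a : ℕ+) (I : List ℕ+) :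
    mul f (sigma y) (I ++ [a]) = f (I ++ [a]) + f I * y ^ (a : ℕ) := by
  unfold mul
  rw [List.length_append, List.length_singleton, Finset.sum_range_succ, Finset.sum_range_succ,
    Finset.sum_eq_zero]
  · have h : (I ++ [a]).take (I.length + 1) = I ++ [a] := List.take_of_length_le (by simp)
    simp [sigma, h, add_comm]
  · intro k hk
    have hk' := Finset.mem_range.mp hk
    have h2 : 2 ≤ ((I ++ [a]).drop k).length := by
      rw [List.length_drop, List.length_append, List.length_singleton]
      omega
    rcases hd : (I ++ [a]).drop k with _ | ⟨b, _ | ⟨c, J⟩⟩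
    · simp [hd] at h2
    · simp [hd] at h2
    · simp [sigma]

/-! ### Monomial expansions of finite products -/

theorem prodRight_sigma_nil (y : ℕ → R) (N : ℕ) :
    prodRight (fun j => sigma (y j)) N [] = 1 := by
  induction N with
  | zero => simp [prodRight, one]
  | succ N ih => simp [prodRight, mul_nil, ih, sigma]

theorem prodRight_lambdaNeg_nil (y : ℕ → R) (N : ℕ) :
    prodRight (fun j => lambdaNeg (y j)) N [] = 1 := by
  induction N with
  | zero => simp [prodRight, one]
  | succ N ih => simp [prodRight, mul_nil, ih, lambdaNeg]

theorem prodRight_zero_concat (g : ℕ → SymSeries R) (I : List ℕ+) (a : ℕ+) :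
    prodRight g 0 (I ++ [a]) = 0 := by
  simp [prodRight, one]

theorem prodRight_sigma_concat (y : ℕ → R) (N : ℕ) (I : List ℕ+) (a : ℕ+) :
    prodRight (fun j => sigma (y j)) (N + 1) (I ++ [a])
      = prodRight (fun j => sigma (y j)) N (I ++ [a])
        + prodRight (fun j => sigma (y j)) N I * y N ^ (a : ℕ) := by
  rw [prodRight, mul_sigma_concat]

/-- Multiplying by `σ_{y_N}` on the right cancels the last factor. The recursion keeps `N + 1`
factors while shortening the composition, which is why indices may repeat. -/
theorem prodRight_lambdaNeg_concat (y : ℕ → R) (N : ℕ) (I : List ℕ+) (a : ℕ+) :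
    prodRight (fun j => lambdaNeg (y j)) (N + 1) (I ++ [a])
      = prodRight (fun j => lambdaNeg (y j)) N (I ++ [a])
        - prodRight (fun j => lambdaNeg (y j)) (N + 1) I * y N ^ (a : ℕ) := by
  have h : mul (prodRight (fun j => lambdaNeg (y j)) (N + 1)) (sigma (y N))
      = prodRight (fun j => lambdaNeg (y j)) N := by
    rw [prodRight, mul_assoc', lambdaNeg_mul_sigma, mul_one']
  rw [eq_sub_iff_add_eq, ← mul_sigma_concat, h]

theorem prodRight_sigma_one (N : ℕ) (I : List ℕ+) :
    prodRight (fun _ => sigma (1 : ℚ)) N I = Ring.choose (N : ℚ) I.length := by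
  induction N generalizing I with
  | zero =>
    rcases List.eq_nil_or_concat I with rfl | ⟨I, a, rfl⟩
    · simp [prodRight, one]
    · rw [List.concat_eq_append, prodRight_zero_concat]
      simp
  | succ N ih =>
    rcases List.eq_nil_or_concat I with rfl | ⟨I, a, rfl⟩
    · rw [prodRight_sigma_nil]
      simp
    · rw [List.concat_eq_append, prodRight_sigma_concat (fun _ => (1 : ℚ)), ih, ih]
      simp [Ring.choose_succ_succ, add_comm]

theorem prodRight_lambdaNeg_one (N : ℕ) (I : List ℕ+) :
    prodRight (fun _ => lambdaNeg (1 : ℚ)) N I = Ring.choose (-(N : ℚ)) I.length := by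
  induction N generalizing I with
  | zero =>
    rcases List.eq_nil_or_concat I with rfl | ⟨I, a, rfl⟩
    · simp [prodRight, one]
    · rw [List.concat_eq_append, prodRight_zero_concat]
      simp
  | succ N ih =>
    induction I using List.reverseRecOn with
    | nil =>
      rw [prodRight_lambdaNeg_nil]
      simp
    | append_singleton I a ih' =>
      rw [prodRight_lambdaNeg_concat (fun _ => (1 : ℚ)), ih, ih']
      -- Pascal's rule with upper entry `-N = -(N+1) + 1`, solved for the binomial with upper entry
      -- `-(N+1)`.
      have h := Ring.choose_succ_succ (-((N : ℚ) + 1)) I.length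
      rw [neg_add, neg_add_cancel_right, ← neg_add] at h
      rw [List.length_append, List.length_singleton, h, one_pow, mul_one, Nat.cast_succ,
        add_sub_cancel_left]

end SymSeries

/-- The sequences `g` of length `k` with values `< N` such that `g i + d ≤ g j` for `i < j`. -/
def gapSeqs (d k N : ℕ) : Finset (Fin k → ℕ) :=
  (Fintype.piFinset fun _ : Fin k => Finset.range N).filter fun g => ∀ i j, i < j → g i + d ≤ g j

theorem mem_gapSeqs {d k N : ℕ} {g : Fin k → ℕ} :
    g ∈ gapSeqs d k N ↔ (∀ i, g i < N) ∧ ∀ i j, i < j → g i + d ≤ g j := by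
  simp [gapSeqs]

theorem sum_gapSeqs_zero {R : Type*} [CommRing R] (d N : ℕ) (f : (Fin 0 → ℕ) → R) :
    ∑ g ∈ gapSeqs d 0 N, f g = f Fin.elim0 := by
  have : gapSeqs d 0 N = {Fin.elim0} := by
    ext g
    rw [mem_gapSeqs, Finset.mem_singleton]
    exact ⟨fun _ => funext fun i => i.elim0, fun _ => ⟨fun i => i.elim0, fun i => i.elim0⟩⟩
  rw [this, Finset.sum_singleton]

theorem gapSeqs_succ_zero (d k : ℕ) : gapSeqs d (k + 1) 0 = ∅ := by
  ext g
  simp [mem_gapSeqs]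

/-- Either the last entry, which is the largest, is below `N`, or it equals `N` and the others are
at most `N - d`. -/
theorem sum_gapSeqs_succ {R : Type*} [CommRing R] {d k N : ℕ} (hd : d ≤ 1)
    (f : (Fin (k + 1) → ℕ) → R) :
    ∑ g ∈ gapSeqs d (k + 1) (N + 1), f g
      = ∑ g ∈ gapSeqs d (k + 1) N, f g
        + ∑ g ∈ gapSeqs d k (N + 1 - d), f (Fin.snoc g N : Fin (k + 1) → ℕ) := by
  classical
  rw [← Finset.sum_filter_not_add_sum_filter _ (fun g => g (Fin.last k) = N)]
  congr 1
  · refine Finset.sum_congr ?_ fun _ _ => rfl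
    ext g
    rw [Finset.mem_filter, mem_gapSeqs, mem_gapSeqs]
    constructor
    · rintro ⟨⟨h1, h2⟩, h3⟩
      refine ⟨fun i => ?_, h2⟩
      have h4 := h1 (Fin.last k)
      rcases (Fin.le_last i).eq_or_lt with rfl | h
      · omega
      · have := h2 i _ h
        omega
    · rintro ⟨h1, h2⟩
      exact ⟨⟨fun i => (h1 i).trans (Nat.lt_succ_self N), h2⟩, (h1 _).ne⟩
  · refine Finset.sum_nbij' (fun g i => g (Fin.castSucc i))
      (fun g => (Fin.snoc g N : Fin (k + 1) → ℕ)) ?_ ?_ ?_ ?_ ?_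
    · intro g hg
      obtain ⟨h0, h3⟩ := Finset.mem_filter.mp hg
      obtain ⟨h1, h2⟩ := mem_gapSeqs.1 h0
      refine mem_gapSeqs.2 ⟨fun i => ?_, fun i j hij => h2 _ _ (Fin.castSucc_lt_castSucc_iff.2 hij)⟩
      have := h2 _ _ (Fin.castSucc_lt_last i)
      have := h1 i.castSucc
      omega
    · intro g hg
      obtain ⟨h1, h2⟩ := mem_gapSeqs.1 hg
      refine Finset.mem_filter.mpr ⟨mem_gapSeqs.2 ⟨fun i => ?_, fun i j hij => ?_⟩, by simp⟩
      · induction i using Fin.lastCases with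
        | last => simp
        | cast i =>
          have := h1 i
          simp only [Fin.snoc_castSucc]
          omega
      · induction i using Fin.lastCases with
        | last => exact absurd hij (Fin.le_last j).not_gt
        | cast i =>
          induction j using Fin.lastCases with
          | last =>
            have := h1 i
            simp only [Fin.snoc_castSucc, Fin.snoc_last]
            omega
          | cast j =>
            simp only [Fin.snoc_castSucc]
            exact h2 i j hij
    · intro g hg
      have h3 := (Finset.mem_filter.mp hg).2
      funext i
      induction i using Fin.lastCases with
      | last => simp [h3]
      | cast i => simp
    · intro g _
      funext i
      simp
    · intro g hg
      have h3 := (Finset.mem_filter.mp hg).2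
      congr 1
      funext i
      induction i using Fin.lastCases with
      | last => simp [h3]
      | cast i => simp

theorem ofFn_succ_concat {k : ℕ} (e : Fin (k + 1) → ℕ+) :
    List.ofFn e = List.ofFn (fun i : Fin k => e i.castSucc) ++ [e (Fin.last k)] := by
  rw [List.ofFn_succ', List.concat_eq_append]

theorem prodRight_sigma_ofFn {R : Type*} [CommRing R] (y : ℕ → R) (N : ℕ) {k : ℕ}
    (e : Fin k → ℕ+) :
    SymSeries.prodRight (fun j => SymSeries.sigma (y j)) N (List.ofFn e)
      = ∑ g ∈ gapSeqs 1 k N, ∏ j, y (g j) ^ (e j : ℕ) := by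
  induction N generalizing k with
  | zero =>
    cases k with
    | zero => rw [sum_gapSeqs_zero]; simp [SymSeries.prodRight, SymSeries.one]
    | succ k => rw [ofFn_succ_concat, SymSeries.prodRight_zero_concat, gapSeqs_succ_zero,
        Finset.sum_empty]
  | succ N ih =>
    cases k with
    | zero => rw [sum_gapSeqs_zero]; simp [SymSeries.prodRight_sigma_nil]
    | succ k =>
      rw [sum_gapSeqs_succ le_rfl, ← ih, ofFn_succ_concat, SymSeries.prodRight_sigma_concat, ih,
        Finset.sum_mul]
      simp [Fin.prod_univ_castSucc]

theorem prodRight_lambdaNeg_ofFn {R : Type*} [CommRing R] (y : ℕ → R) (N : ℕ) {k : ℕ}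
    (e : Fin k → ℕ+) :
    SymSeries.prodRight (fun j => SymSeries.lambdaNeg (y j)) N (List.ofFn e)
      = (-1) ^ k * ∑ g ∈ gapSeqs 0 k N, ∏ j, y (g j) ^ (e j : ℕ) := by
  induction N generalizing k with
  | zero =>
    cases k with
    | zero => rw [sum_gapSeqs_zero]; simp [SymSeries.prodRight, SymSeries.one]
    | succ k => rw [ofFn_succ_concat, SymSeries.prodRight_zero_concat, gapSeqs_succ_zero,
        Finset.sum_empty, mul_zero]
  | succ N ih =>
    -- An inner induction on the length is needed because the recursion refers to a shorter
    -- composition with the same number of factors.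
    induction k with
    | zero => rw [sum_gapSeqs_zero]; simp [SymSeries.prodRight_lambdaNeg_nil]
    | succ k ihk =>
      rw [sum_gapSeqs_succ zero_le_one, mul_add, ← ih, ofFn_succ_concat,
        SymSeries.prodRight_lambdaNeg_concat, ihk, sub_eq_add_neg, pow_succ, mul_assoc, mul_assoc,
        Finset.sum_mul]
      simp [Fin.prod_univ_castSucc]

/-! ### Sums over words on an interval -/

/-- The words of length `n` over the alphabet `{a_c, …, a_{c+N-1}}`. -/
noncomputable def intervalWords (n : ℕ) (c : ℤ) (N : ℕ) : Finset (Fin n → ℤ) :=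
  Fintype.piFinset fun _ : Fin n => Finset.Ico c (c + N)

theorem mem_intervalWords {c : ℤ} {N : ℕ} {w : Fin n → ℤ} :
    w ∈ intervalWords n c N ↔ ∀ i, c ≤ w i ∧ w i < c + N := by
  simp [intervalWords]

open Classical in
-- A word constant on the blocks of `u` is a sequence of block letters, each variable being raised
-- to the block size. Gap `1` will describe the words with packing `u`, gap `0` those whose packing
-- is a coarsening of `u`.
theorem sum_intervalWords_gap {R : Type*} [CommRing R] (u : PackedWord n) (y : ℤ → R) (c : ℤ)
    (N d : ℕ) :
    ∑ w ∈ (intervalWords n c N).filter (fun w =>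
        (∀ i j, u.1 i < u.1 j → w i + (d : ℤ) ≤ w j) ∧ ∀ i j, u.1 i = u.1 j → w i = w j),
        ∏ i, y (w i)
      = ∑ g ∈ gapSeqs d (maxLetter u.1) N, ∏ k : Fin (maxLetter u.1), y (c + g k) ^
          (Finset.univ.filter (fun i => u.1 i = (k : ℕ) + 1)).card := by
  obtain ⟨r, s, hr, hrs⟩ := packedWord_section u
  have hus : ∀ i, u.1 (s (r i)) = u.1 i := fun i => by rw [← hr, hrs, hr]
  have hs : ∀ a, u.1 (s a) = (a : ℕ) + 1 := fun a => by rw [← hr, hrs]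
  symm
  refine Finset.sum_nbij' (fun g i => c + g (r i)) (fun w a => (w (s a) - c).toNat) ?_ ?_ ?_ ?_ ?_
  · intro g hg
    obtain ⟨h1, h2⟩ := mem_gapSeqs.1 hg
    refine Finset.mem_filter.mpr ⟨mem_intervalWords.2 fun i => ?_, fun i j hij => ?_,
      fun i j hij => ?_⟩
    · have := h1 (r i)
      omega
    · have hi := hr i
      have hj := hr j
      have := h2 (r i) (r j) (Fin.lt_def.2 (by omega))
      simp only
      omega
    · have hi := hr i
      have hj := hr j
      have : r i = r j := Fin.ext (by omega)
      simp only [this]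
  · intro w hw
    obtain ⟨h1, h2, h3⟩ := Finset.mem_filter.mp hw
    rw [mem_intervalWords] at h1
    refine mem_gapSeqs.2 ⟨fun a => ?_, fun a b hab => ?_⟩
    · have := h1 (s a)
      omega
    · have := h2 (s a) (s b) (by rw [hs, hs]; exact Nat.succ_lt_succ hab)
      have := h1 (s a)
      have := h1 (s b)
      omega
  · intro g _
    funext a
    simp [hrs]
  · intro w hw
    obtain ⟨h1, h2, h3⟩ := Finset.mem_filter.mp hw
    rw [mem_intervalWords] at h1
    funext i
    have := h1 (s (r i))
    have := h3 _ _ (hus i)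
    simp only
    omega
  · intro g _
    rw [← Finset.prod_fiberwise' Finset.univ r (fun k => y (c + g k))]
    refine Finset.prod_congr rfl fun k _ => ?_
    rw [Finset.prod_const]
    congr 2
    ext i
    have := hr i
    simp only [Finset.mem_filter, Finset.mem_univ, true_and, Fin.ext_iff]
    omega

theorem evaluation_eq_ofFn (u : PackedWord n) :
    ∃ e : Fin (maxLetter u.1) → ℕ+, evaluation u = List.ofFn e ∧
      ∀ k, (e k : ℕ) = (Finset.univ.filter (fun i => u.1 i = (k : ℕ) + 1)).card :=
  ⟨_, rfl, fun _ => rfl⟩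

open Classical in
theorem sum_intervalWords_pack_eq {R : Type*} [CommRing R] (u : PackedWord n) (y : ℤ → R) (c : ℤ)
    (N : ℕ) :
    ∑ w ∈ (intervalWords n c N).filter (fun w => pack w = u), ∏ i, y (w i)
      = SymSeries.prodRight (fun j => SymSeries.sigma (y (c + j))) N (evaluation u) := by
  obtain ⟨e, he, hcard⟩ := evaluation_eq_ofFn u
  rw [he, prodRight_sigma_ofFn (fun j => y (c + j))]
  simp only [hcard]
  rw [← sum_intervalWords_gap]
  refine Finset.sum_congr (Finset.filter_congr fun w _ => ?_) fun _ _ => rfl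
  constructor
  · rintro rfl
    simp only [pack_lt_iff, pack_inj_iff]
    exact ⟨fun i j h => by push_cast; omega, fun i j h => h⟩
  · rintro ⟨h1, h2⟩
    exact pack_eq_of_lt_of_eq w u (fun i j h => by have := h1 i j h; push_cast at this; omega) h2

open Classical in
theorem sum_intervalWords_coarsenings {R : Type*} [CommRing R] (u : PackedWord n) (y : ℤ → R)
    (c : ℤ) (N : ℕ) :
    (-1) ^ maxLetter u.1 *
        ∑ w ∈ (intervalWords n c N).filter (fun w => pack w ∈ coarsenings u), ∏ i, y (w i)
      = SymSeries.prodRight (fun j => SymSeries.lambdaNeg (y (c + j))) N (evaluation u) := by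
  obtain ⟨e, he, hcard⟩ := evaluation_eq_ofFn u
  rw [he, prodRight_lambdaNeg_ofFn (fun j => y (c + j))]
  simp only [hcard]
  rw [← sum_intervalWords_gap]
  congr 1
  refine Finset.sum_congr (Finset.filter_congr fun w _ => ?_) fun _ _ => rfl
  rw [mem_coarsenings]
  unfold Refines
  simp only [pack_le_iff, Nat.cast_zero, add_zero]
  constructor
  · intro h
    exact ⟨fun i j hij => h i j hij.le, fun i j hij =>
      le_antisymm (h i j hij.le) (h j i hij.ge)⟩
  · rintro ⟨h1, h2⟩ i j hij
    rcases hij.lt_or_eq with h | h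
    · exact h1 i j h
    · exact (h2 i j h).le

namespace SymSeries

/-! ### Scaling and the `q`-exponential series -/

/-- The weight `i_1 + ⋯ + i_r` of a composition. -/
def weight (I : List ℕ+) : ℕ := (I.map fun k : ℕ+ => (k : ℕ)).sum

@[simp] theorem weight_nil : weight [] = 0 := rfl

@[simp] theorem weight_cons (a : ℕ+) (I : List ℕ+) : weight (a :: I) = a + weight I := by
  simp [weight]

theorem weight_append (I J : List ℕ+) : weight (I ++ J) = weight I + weight J := by
  simp [weight]

theorem weight_pos {I : List ℕ+} (h : I ≠ []) : weight I ≠ 0 := by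
  rcases I with _ | ⟨a, I⟩
  · exact absurd rfl h
  · have := a.pos
    rw [weight_cons]
    omega

section CommRing

variable {R : Type*} [CommRing R]

/-- The substitution `A ↦ yA`, that is `S^I ↦ y^{|I|} S^I`. -/
def scale (y : R) (f : SymSeries R) : SymSeries R := fun I => y ^ weight I * f I

theorem scale_mul (y : R) (f g : SymSeries R) :
    scale y (mul f g) = mul (scale y f) (scale y g) := by
  funext I
  unfold scale mul
  rw [Finset.mul_sum]
  refine Finset.sum_congr rfl fun k _ => ?_
  have h : weight I = weight (I.take k) + weight (I.drop k) := by
    rw [← weight_append, List.take_append_drop]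
  rw [h, pow_add]
  ring

theorem scale_scale (x y : R) (f : SymSeries R) : scale x (scale y f) = scale (x * y) f := by
  funext I
  simp only [scale, mul_pow, mul_assoc]

theorem scale_one (y : R) : scale y one = one := by
  funext I
  by_cases h : I = [] <;> simp [scale, one, h]

theorem one_scale (f : SymSeries R) : scale 1 f = f := by
  funext I
  simp [scale]

theorem scale_sigma_one (y : R) : scale y (sigma 1) = sigma y := by
  funext I
  rcases I with _ | ⟨a, _ | ⟨b, I⟩⟩ <;> simp [scale, sigma]

/-- Induction on the length of the composition: with constant term `1`, the top term of each
coefficient is determined by shorter ones. -/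
theorem mul_left_cancel' {f a b : SymSeries R} (hf : f [] = 1) (h : mul f a = mul f b) :
    a = b := by
  have key : ∀ N, ∀ I : List ℕ+, I.length ≤ N → a I = b I := by
    intro N
    induction N with
    | zero =>
      intro I hI
      have hI' : I = [] := List.length_eq_zero_iff.1 (by omega)
      subst hI'
      have := congrFun h []
      simpa [mul_nil, hf] using this
    | succ N ih =>
      intro I hI
      have h1 := congrFun h I
      unfold mul at h1
      rw [Finset.sum_range_succ', Finset.sum_range_succ'] at h1
      have h2 : ∀ k ∈ Finset.range I.length, f (I.take (k + 1)) * a (I.drop (k + 1))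
          = f (I.take (k + 1)) * b (I.drop (k + 1)) := fun k hk => by
        rw [ih _ (by rw [List.length_drop]; omega)]
      rw [Finset.sum_congr rfl h2] at h1
      simpa [hf] using h1
  funext I
  exact key _ I le_rfl

end CommRing

section Field

variable {K : Type*} [Field K]

/-- The coefficients of `σ_1 σ_q σ_{q²} ⋯`. -/
def qSigma (q : K) : SymSeries K
  | [] => 1
  | a :: I => q ^ weight I / (1 - q ^ weight (a :: I)) * qSigma q I

/-- The coefficients of the inverse of `σ_1 σ_q σ_{q²} ⋯`, on reversed compositions. -/
def qLambdaRev (q : K) : SymSeries K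
  | [] => 1
  | a :: I => -(1 / (1 - q ^ weight (a :: I))) * qLambdaRev q I

/-- The coefficients of `⋯ λ_{-q²} λ_{-q} λ_{-1}`. -/
def qLambda (q : K) : SymSeries K := fun I => qLambdaRev q I.reverse

theorem weight_reverse (I : List ℕ+) : weight I.reverse = weight I := by
  simp [weight, List.map_reverse, List.sum_reverse]

theorem qLambda_concat (q : K) (I : List ℕ+) (a : ℕ+) :
    qLambda q (I ++ [a]) = -(1 / (1 - q ^ weight (I ++ [a]))) * qLambda q I := by
  unfold qLambda
  rw [List.reverse_append, List.reverse_singleton, List.singleton_append, qLambdaRev, weight_cons,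
    weight_reverse, weight_append, add_comm]
  simp

variable {q : K}

theorem one_sub_pow_weight_ne_zero (hq : ∀ k : ℕ, k ≠ 0 → q ^ k ≠ 1) {I : List ℕ+} (hI : I ≠ []) :
    1 - q ^ weight I ≠ 0 :=
  sub_ne_zero.2 (hq _ (weight_pos hI)).symm

/-- Formally, removing the first factor of `σ_1 σ_q σ_{q²} ⋯` leaves the same product at `qA`. On
coefficients this is the recursion that defines `qSigma`, with nonzero denominators as no positive
power of `q` is `1`. -/
theorem sigma_mul_scale_qSigma (hq : ∀ k : ℕ, k ≠ 0 → q ^ k ≠ 1) :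
    mul (sigma 1) (scale q (qSigma q)) = qSigma q := by
  funext I
  rcases I with _ | ⟨a, I⟩
  · simp [mul_nil, sigma, scale, qSigma]
  · have h := one_sub_pow_weight_ne_zero hq (List.cons_ne_nil a I)
    rw [sigma_mul_cons]
    simp only [scale, qSigma, one_pow, one_mul]
    field_simp
    ring

theorem qLambda_mul_sigma (hq : ∀ k : ℕ, k ≠ 0 → q ^ k ≠ 1) :
    mul (qLambda q) (sigma 1) = scale q (qLambda q) := by
  funext I
  rcases List.eq_nil_or_concat I with rfl | ⟨I, a, rfl⟩
  · simp [mul_nil, sigma, scale, qLambda, qLambdaRev]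
  · rw [List.concat_eq_append]
    have h := one_sub_pow_weight_ne_zero hq (I := I ++ [a]) (by simp)
    rw [mul_sigma_concat]
    simp only [scale, qLambda_concat, one_pow, mul_one]
    field_simp
    ring

/-- By the two functional equations the product is invariant under `A ↦ qA`, so all its coefficients
of positive weight vanish. -/
theorem qLambda_mul_qSigma (hq : ∀ k : ℕ, k ≠ 0 → q ^ k ≠ 1) :
    mul (qLambda q) (qSigma q) = one := by
  have h : scale q (mul (qLambda q) (qSigma q)) = mul (qLambda q) (qSigma q) := by
    rw [scale_mul, ← qLambda_mul_sigma hq, mul_assoc', sigma_mul_scale_qSigma hq]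
  funext I
  by_cases hI : I = []
  · subst hI
    simp [mul_nil, qLambda, qLambdaRev, qSigma, one]
  · have h1 := congrFun h I
    have h2 := one_sub_pow_weight_ne_zero hq hI
    rw [scale] at h1
    have h3 : (1 - q ^ weight I) * mul (qLambda q) (qSigma q) I = 0 := by
      rw [sub_mul, h1]
      ring
    simpa [one, hI] using (mul_eq_zero.1 h3).resolve_left h2

theorem qSigma_mul_qLambda (hq : ∀ k : ℕ, k ≠ 0 → q ^ k ≠ 1) :
    mul (qSigma q) (qLambda q) = one := by
  refine mul_left_cancel' (f := qLambda q) rfl ?_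
  rw [← mul_assoc', qLambda_mul_qSigma hq, one_mul', mul_one']

theorem sigma_mul_scale_scale (hq : ∀ k : ℕ, k ≠ 0 → q ^ k ≠ 1) (y : K) :
    mul (sigma y) (scale (y * q) (qSigma q)) = scale y (qSigma q) := by
  rw [← scale_sigma_one, ← scale_scale, ← scale_mul, sigma_mul_scale_qSigma hq]

/-- Multiplying by the tail, which is `qSigma` at `q^N A`, telescopes to `qSigma`; the tail is then
inverted. -/
theorem prodRight_sigma_eq (hq : ∀ k : ℕ, k ≠ 0 → q ^ k ≠ 1) (N : ℕ) :
    prodRight (fun i => sigma (q ^ i)) N = mul (qSigma q) (scale (q ^ N) (qLambda q)) := by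
  have h : mul (prodRight (fun i => sigma (q ^ i)) N) (scale (q ^ N) (qSigma q)) = qSigma q := by
    induction N with
    | zero => rw [prodRight, one_mul', pow_zero, one_scale]
    | succ N ih => rw [prodRight, mul_assoc', pow_succ, sigma_mul_scale_scale hq, ih]
  rw [← h, mul_assoc', ← scale_mul, qSigma_mul_qLambda hq, scale_one, mul_one']

theorem prodLeft_lambdaNeg_eq (hq : ∀ k : ℕ, k ≠ 0 → q ^ k ≠ 1) (t : K) (N : ℕ) :
    prodLeft (fun j => lambdaNeg (q ^ (j + 1) * t)) N
      = mul (scale (q ^ (N + 1) * t) (qSigma q)) (scale (q * t) (qLambda q)) := by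
  induction N with
  | zero => rw [zero_add, pow_one, ← scale_mul, qSigma_mul_qLambda hq, scale_one, prodLeft]
  | succ N ih =>
    rw [prodLeft, ih, ← sigma_mul_scale_scale hq (q ^ (N + 1) * t), mul_assoc', ← mul_assoc',
      lambdaNeg_mul_sigma, one_mul']
    congr 2
    ring

/-- The functional equation of `qLambda`, scaled by `q^{-(N+1)}`, produces a factor `σ` that the new
factor `λ` cancels. -/
theorem prodRight_lambdaNeg_zpow (hq : ∀ k : ℕ, k ≠ 0 → q ^ k ≠ 1) (hq0 : q ≠ 0) (N : ℕ) :
    prodRight (fun i => lambdaNeg (q ^ (-((i : ℤ) + 1)))) N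
      = mul (qSigma q) (scale (q ^ (-(N : ℤ))) (qLambda q)) := by
  induction N with
  | zero => simp [prodRight, one_scale, qSigma_mul_qLambda hq]
  | succ N ih =>
    have h1 : q ^ (-(N : ℤ)) = q ^ (-((N : ℤ) + 1)) * q := by
      rw [← zpow_add_one₀ hq0]
      congr 1
      ring
    have h2 : scale (q ^ (-(N : ℤ))) (qLambda q)
        = mul (scale (q ^ (-((N : ℤ) + 1))) (qLambda q)) (sigma (q ^ (-((N : ℤ) + 1)))) := by
      rw [h1, ← scale_scale, ← qLambda_mul_sigma hq, scale_mul, scale_sigma_one]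
    rw [prodRight, ih, h2, mul_assoc', mul_assoc', sigma_mul_lambdaNeg, mul_one', Nat.cast_succ]

/-! ### Convergence -/

variable [TopologicalSpace K] [IsTopologicalRing K]

theorem tendsto_mul {f g : ℕ → SymSeries K} {f' g' : SymSeries K}
    (hf : ∀ I, Tendsto (fun N => f N I) atTop (𝓝 (f' I)))
    (hg : ∀ I, Tendsto (fun N => g N I) atTop (𝓝 (g' I))) (I : List ℕ+) :
    Tendsto (fun N => mul (f N) (g N) I) atTop (𝓝 (mul f' g' I)) :=
  tendsto_finsetSum _ fun _ _ => (hf _).mul (hg _)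

/-- Nonempty compositions have positive weight, so their coefficients carry a positive power of `y
N`. -/
theorem tendsto_scale {y : ℕ → K} (hy : Tendsto y atTop (𝓝 0)) {f : SymSeries K} (hf : f [] = 1)
    (I : List ℕ+) : Tendsto (fun N => scale (y N) f I) atTop (𝓝 ((one : SymSeries K) I)) := by
  by_cases hI : I = []
  · subst hI
    simpa [scale, hf, one] using tendsto_const_nhds
  · have h := (hy.pow (weight I)).mul_const (f I)
    rw [zero_pow (weight_pos hI), zero_mul] at h
    simpa only [scale, one, if_neg hI] using h

theorem tendsto_prodRight_sigma (hq : ∀ k : ℕ, k ≠ 0 → q ^ k ≠ 1)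
    (h0 : Tendsto (fun N => q ^ N) atTop (𝓝 0)) (I : List ℕ+) :
    Tendsto (fun N => prodRight (fun i => sigma (q ^ i)) N I) atTop (𝓝 (qSigma q I)) := by
  simp only [prodRight_sigma_eq hq]
  have := tendsto_mul (f := fun _ => qSigma q) (fun _ => tendsto_const_nhds)
    (tendsto_scale h0 (f := qLambda q) rfl) I
  rwa [mul_one'] at this

theorem tendsto_prodLeft_lambdaNeg (hq : ∀ k : ℕ, k ≠ 0 → q ^ k ≠ 1)
    (h0 : Tendsto (fun N => q ^ N) atTop (𝓝 0)) (t : K) (I : List ℕ+) :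
    Tendsto (fun N => prodLeft (fun j => lambdaNeg (q ^ (j + 1) * t)) N I) atTop
      (𝓝 (scale (q * t) (qLambda q) I)) := by
  simp only [prodLeft_lambdaNeg_eq hq]
  have h1 : Tendsto (fun N => q ^ (N + 1) * t) atTop (𝓝 0) := by
    simpa using ((tendsto_add_atTop_iff_nat 1).2 h0).mul_const t
  have := tendsto_mul (tendsto_scale h1 (f := qSigma q) rfl)
    (g := fun _ => scale (q * t) (qLambda q)) (fun _ => tendsto_const_nhds) I
  rwa [one_mul'] at this

end Field

/-! ### Naturality -/

/-- Used for `ℚ(q) → ℚ((q))`: limits are taken in Laurent series, but the closed forms have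
coefficients in `ℚ(q)`. -/
theorem map_qSigma {K K' : Type*} [Field K] [Field K'] (φ : K →+* K') (q : K) (I : List ℕ+) :
    φ (qSigma q I) = qSigma (φ q) I := by
  induction I with
  | nil => simp [qSigma]
  | cons a I ih => simp [qSigma, ih]

theorem map_qLambda {K K' : Type*} [Field K] [Field K'] (φ : K →+* K') (q : K) (I : List ℕ+) :
    φ (qLambda q I) = qLambda (φ q) I := by
  unfold qLambda
  induction I.reverse with
  | nil => simp [qLambdaRev]
  | cons a I ih => simp [qLambdaRev, ih]

end SymSeries

/-! ### The alphabet `X_{q,t}` -/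

theorem qL_zpow (k : ℤ) : qL ^ k = HahnSeries.single k 1 := by
  rw [qL, ← RatFunc.single_zpow]

theorem qL_pow (k : ℕ) : qL ^ k = HahnSeries.single (k : ℤ) 1 := by
  rw [← zpow_natCast, qL_zpow]

theorem qL_pow_ne_one (k : ℕ) (hk : k ≠ 0) : qL ^ k ≠ 1 := by
  intro h
  have h1 := congrArg (fun f : ℚ⸨X⸩ => f.coeff 0) h
  have h2 : ((0 : ℤ) = (k : ℤ)) = False := by
    rw [eq_iff_iff, iff_false]
    omega
  rw [qL_pow] at h1
  simp [HahnSeries.coeff_one, h2] at h1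

theorem qL_ne_zero : qL ≠ 0 := by
  simp [qL]

theorem ratToLaurent_qR : ratToLaurent ℚ qR = qL := RatFunc.coe_X

theorem tendsto_qL_pow : Tendsto (fun N : ℕ => qL ^ N) atTop (𝓝 0) := by
  rw [(Valued.hasBasis_nhds_zero _ _).tendsto_right_iff]
  intro γ _
  have h0 : MonoidWithZeroHom.ValueGroup₀.embedding γ.1 ≠ 0 := (_root_.map_ne_zero _).2 γ.ne_zero
  -- The valuation of `q^N` is `exp (-N)`, which drops below `γ` once `N` exceeds `-log γ`.
  filter_upwards [eventually_gt_atTop (-WithZero.log (MonoidWithZeroHom.ValueGroup₀.embedding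
    γ.1)).toNat] with N hN
  rw [Valuation.restrict_lt_iff_lt_embedding, qL_pow,
    LaurentSeries.valuation_single_zpow, ← WithZero.exp_log h0, WithZero.exp_lt_exp]
  omega

theorem infProdRight_eq :
    SymSeries.infProdRight (fun i => SymSeries.sigma (qL ^ i)) = SymSeries.qSigma qL :=
  funext fun I => (SymSeries.tendsto_prodRight_sigma qL_pow_ne_one tendsto_qL_pow I).limUnder_eq

theorem infProdLeft_eq (t : ℚ⸨X⸩) :
    SymSeries.infProdLeft (fun j => SymSeries.lambdaNeg (qL ^ (j + 1) * t))
      = SymSeries.scale (qL * t) (SymSeries.qLambda qL) :=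
  funext fun I =>
    (SymSeries.tendsto_prodLeft_lambdaNeg qL_pow_ne_one tendsto_qL_pow t I).limUnder_eq

theorem alphabetQT_eq (t : ℚ⸨X⸩) :
    alphabetQT t
      = SymSeries.mul (SymSeries.qSigma qL) (SymSeries.scale (qL * t) (SymSeries.qLambda qL)) := by
  rw [alphabetQT, infProdRight_eq, infProdLeft_eq]

theorem alphabetQT_pow (m : ℕ) :
    alphabetQT (qL ^ m) = SymSeries.prodRight (fun i => SymSeries.sigma (qL ^ i)) (m + 1) := by
  rw [alphabetQT_eq, SymSeries.prodRight_sigma_eq qL_pow_ne_one, pow_succ']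

/-- The second factor is scaled by `q · q^{-m} = q^{-(m-1)}`, whence `m - 1` factors. -/
theorem alphabetQT_zpow_neg {m : ℕ} (hm : 1 ≤ m) :
    alphabetQT (qL ^ (-(m : ℤ))) =
      SymSeries.prodRight (fun i => SymSeries.lambdaNeg (qL ^ (-((i : ℤ) + 1)))) (m - 1) := by
  rw [alphabetQT_eq, SymSeries.prodRight_lambdaNeg_zpow qL_pow_ne_one qL_ne_zero]
  congr 2
  rw [← zpow_one_add₀ qL_ne_zero, Nat.cast_sub hm]
  congr 1
  push_cast
  ring

/-! ### Specializations of `Γ_P` -/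

theorem atScalar_sum_M (α : ℚ) (T : Finset (PackedWord n)) :
    atScalar α (∑ u ∈ T, M u) = ∑ u ∈ T, Ring.choose α (evaluation u).length := by
  classical
  unfold atScalar
  rw [Finsupp.sum_fintype _ _ (by simp)]
  simp [sum_M_apply, Finset.sum_ite_mem]

theorem atSeries_sum_M {K : Type*} [Field K] [Algebra ℚ K] (X : SymSeries K)
    (T : Finset (PackedWord n)) : atSeries X (∑ u ∈ T, M u) = ∑ u ∈ T, X (evaluation u) := by
  classical
  unfold atSeries
  rw [Finsupp.sum_fintype _ _ (by simp)]
  simp only [sum_M_apply, apply_ite (algebraMap ℚ K), map_one, map_zero, ite_mul, one_mul,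
    zero_mul]
  rw [Finset.sum_ite_mem, Finset.univ_inter]

open Classical in
theorem points_eq (P : Fin n → Fin n → Prop) (m : ℕ) :
    points P m = (intervalWords n 0 (m + 1)).filter (fun w => ∀ i j, P i j → w i ≤ w j) := by
  ext w
  rw [points, Set.Finite.mem_toFinset, mem_integerPoints_smul, Finset.mem_filter,
    mem_intervalWords]
  refine and_congr_left fun _ => forall_congr' fun i => ?_
  rw [Set.mem_Icc]
  push_cast
  omega

open Classical in
theorem interiorPoints_eq {P : Fin n → Fin n → Prop} (hnat : ∀ i j, P i j → i < j) {m : ℕ}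
    (hm : 1 ≤ m) :
    interiorPoints P m
      = (intervalWords n 1 (m - 1)).filter (fun w => ∀ i j, P i j → w i < w j) := by
  ext w
  rw [interiorPoints, Set.Finite.mem_toFinset, mem_integerPoints_interior_smul hnat,
    Finset.mem_filter, mem_intervalWords]
  refine and_congr_left fun _ => forall_congr' fun i => ?_
  rw [Set.mem_Icc]
  omega

/-- Lattice points of `m Q_P` are words on the `m + 1` letters `0, …, m`; they are sorted here by
their packing. -/
theorem sum_weakWords_prodRight_sigma {R : Type*} [CommRing R] (P : Fin n → Fin n → Prop)
    (y : ℤ → R) (m : ℕ) :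
    ∑ u ∈ weakWords P,
        SymSeries.prodRight (fun j => SymSeries.sigma (y (0 + j))) (m + 1) (evaluation u)
      = ∑ z ∈ points P m, ∏ i, y (z i) := by
  classical
  simp only [← sum_intervalWords_pack_eq]
  rw [Finset.sum_fiberwise_eq_sum_filter, points_eq]
  simp only [pack_mem_weakWords]

theorem negAlphabet_gamma_apply {P : Fin n → Fin n → Prop} (hnat : ∀ i j, P i j → i < j)
    (v : PackedWord n) [∀ u, Decidable (v ∈ coarsenings u)] :
    negAlphabet (gamma P) v
      = ∑ u ∈ weakWords P, (-1) ^ maxLetter u.1 * if v ∈ coarsenings u then 1 else 0 := by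
  rw [gamma_eq_sum_weakWords P hnat, map_sum, Finsupp.finsetSum_apply]
  simp only [negAlphabet_M, Finsupp.smul_apply, sum_M_apply, smul_eq_mul]

/-- Both sides sum `(-1)^max(u)` times a monomial over pairs `(u, w)` with `pack w ≤ u`, grouped by
`u` on the left and by `w` on the right. -/
theorem sum_weakWords_prodRight_lambdaNeg {K : Type*} [Field K] [Algebra ℚ K]
    {P : Fin n → Fin n → Prop} (hnat : ∀ i j, P i j → i < j) (y : ℤ → K) (c : ℤ) (N : ℕ) :
    ∑ u ∈ weakWords P,
        SymSeries.prodRight (fun j => SymSeries.lambdaNeg (y (c + j))) N (evaluation u)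
      = ∑ w ∈ intervalWords n c N,
          algebraMap ℚ K (negAlphabet (gamma P) (pack w)) * ∏ i, y (w i) := by
  classical
  simp only [← sum_intervalWords_coarsenings, negAlphabet_gamma_apply hnat, map_sum, map_mul,
    map_pow, map_neg, map_one, apply_ite (algebraMap ℚ K), map_zero, Finset.sum_mul]
  rw [Finset.sum_comm]
  refine Finset.sum_congr rfl fun u _ => ?_
  rw [Finset.sum_filter, Finset.mul_sum]
  refine Finset.sum_congr rfl fun w _ => ?_
  split_ifs <;> simp

theorem neg_one_pow_mul_sum_prodRight_lambdaNeg {K : Type*} [Field K] [Algebra ℚ K]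
    {P : Fin n → Fin n → Prop} (hnat : ∀ i j, P i j → i < j) (y : ℤ → K) {m : ℕ} (hm : 1 ≤ m) :
    (-1) ^ n * ∑ u ∈ weakWords P,
        SymSeries.prodRight (fun j => SymSeries.lambdaNeg (y (1 + j))) (m - 1) (evaluation u)
      = ∑ z ∈ interiorPoints P m, ∏ i, y (z i) := by
  classical
  rw [sum_weakWords_prodRight_lambdaNeg hnat, interiorPoints_eq hnat hm, Finset.sum_filter,
    Finset.mul_sum]
  refine Finset.sum_congr rfl fun w _ => ?_
  have h := DFunLike.congr_fun (neg_one_pow_smul_negAlphabet_gamma hnat) (pack w)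
  rw [Finsupp.smul_apply, sum_M_apply, smul_eq_mul] at h
  simp only [pack_mem_strictWords] at h
  have h' := congrArg (algebraMap ℚ K) h
  rw [map_mul, map_pow, map_neg, map_one] at h'
  rw [← mul_assoc, h']
  split_ifs <;> simp

theorem prod_zpow_eq_zpow_sum {K : Type*} [Field K] {q : K} (hq : q ≠ 0) (z : Fin n → ℤ) :
    ∏ i, q ^ z i = q ^ ∑ i, z i := by
  induction n with
  | zero => simp
  | succ n ih => rw [Fin.prod_univ_succ, Fin.sum_univ_succ, zpow_add₀ hq, ih]

/-! ### The Ehrhart polynomial -/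

theorem atScalar_gamma_succ {P : Fin n → Fin n → Prop} (hnat : ∀ i j, P i j → i < j) (m : ℕ) :
    atScalar ((m : ℚ) + 1) (gamma P) = ((points P m).card : ℚ) := by
  have h := sum_weakWords_prodRight_sigma P (fun _ => (1 : ℚ)) m
  simp only [SymSeries.prodRight_sigma_one, Finset.prod_const_one, Finset.sum_const,
    nsmul_eq_mul, mul_one] at h
  rw [gamma_eq_sum_weakWords P hnat, atScalar_sum_M, ← h]
  push_cast
  rfl

theorem atScalar_gamma_neg {P : Fin n → Fin n → Prop} (hnat : ∀ i j, P i j → i < j) {m : ℕ}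
    (hm : 1 ≤ m) :
    (-1 : ℚ) ^ n * atScalar (1 - (m : ℚ)) (gamma P) = ((interiorPoints P m).card : ℚ) := by
  have h := neg_one_pow_mul_sum_prodRight_lambdaNeg hnat (fun _ => (1 : ℚ)) hm
  simp only [SymSeries.prodRight_lambdaNeg_one, Finset.prod_const_one, Finset.sum_const,
    nsmul_eq_mul, mul_one] at h
  rw [gamma_eq_sum_weakWords P hnat, atScalar_sum_M, ← h, Nat.cast_sub hm]
  simp

theorem exists_polynomial_choose (k : ℕ) : ∃ p : ℚ[X], ∀ α : ℚ, p.eval α = Ring.choose α k := by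
  refine ⟨C ((k.factorial : ℚ)⁻¹) * (descPochhammer ℤ k).map (Int.castRingHom ℚ), fun α => ?_⟩
  rw [Ring.choose_eq_smul, eval_mul, eval_C, eval_map, smul_eq_mul]
  congr 1
  rw [← eval₂_smulOneHom_eq_smeval]
  congr 1
  exact Subsingleton.elim _ _

theorem exists_polynomial_atScalar {P : Fin n → Fin n → Prop} (hnat : ∀ i j, P i j → i < j) :
    ∃ E : ℚ[X], ∀ α : ℚ, E.eval α = atScalar (α + 1) (gamma P) := by
  choose p hp using exists_polynomial_choose
  -- The shift by one reflects that the `m`-th dilate uses `m + 1` letters.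
  refine ⟨∑ u ∈ weakWords P, (p (evaluation u).length).comp (X + 1), fun α => ?_⟩
  rw [gamma_eq_sum_weakWords P hnat, atScalar_sum_M, eval_finsetSum]
  simp [hp]

theorem polynomial_eq_of_eval_natSeq {K : Type*} [Field K] {p p' : K[X]} {s : ℕ → K}
    (hs : Function.Injective s) (h : ∀ m, p.eval (s m) = p'.eval (s m)) : p = p' :=
  Polynomial.eq_of_infinite_eval_eq p p' (Set.infinite_of_injective_forall_mem hs h)

/-! ### `q`-specializations -/

theorem atSeries_gamma_pow {P : Fin n → Fin n → Prop} (hnat : ∀ i j, P i j → i < j) (m : ℕ) :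
    atSeries (alphabetQT (qL ^ m)) (gamma P) = ∑ z ∈ points P m, qL ^ (∑ i, z i) := by
  have h := sum_weakWords_prodRight_sigma P (fun z => qL ^ z) m
  simp only [zero_add, zpow_natCast, prod_zpow_eq_zpow_sum qL_ne_zero] at h
  rw [gamma_eq_sum_weakWords P hnat, atSeries_sum_M, alphabetQT_pow, h]

theorem alphabetQT_zpow_neg' {m : ℕ} (hm : 1 ≤ m) :
    alphabetQT (qL ^ (-(m : ℤ))) =
      SymSeries.prodRight (fun i => SymSeries.lambdaNeg (qL ^ (-(1 + (i : ℤ))))) (m - 1) := by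
  simp only [alphabetQT_zpow_neg hm, add_comm]

theorem piFinset_Icc_eq_intervalWords {m : ℕ} (hm : 1 ≤ m) :
    (Fintype.piFinset fun _ : Fin n => Finset.Icc (1 : ℤ) ((m : ℤ) - 1))
      = intervalWords n 1 (m - 1) := by
  ext w
  rw [mem_intervalWords, Fintype.mem_piFinset]
  refine forall_congr' fun i => ?_
  rw [Finset.mem_Icc]
  omega

theorem atSeries_gamma_zpow_neg {P : Fin n → Fin n → Prop} (hnat : ∀ i j, P i j → i < j) {m : ℕ}
    (hm : 1 ≤ m) :
    atSeries (alphabetQT (qL ^ (-(m : ℤ)))) (gamma P) =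
      ∑ w ∈ Fintype.piFinset (fun _ : Fin n => Finset.Icc (1 : ℤ) ((m : ℤ) - 1)),
        algebraMap ℚ (LaurentSeries ℚ)
          (onAlphabet (Set.Icc 1 ((m : ℤ) - 1)) (negAlphabet (gamma P)) w) *
            ∏ i, qL ^ (-(w i)) := by
  have h := sum_weakWords_prodRight_lambdaNeg hnat (fun z => qL ^ (-z)) 1 (m - 1)
  conv_lhs => rw [gamma_eq_sum_weakWords P hnat]
  rw [atSeries_sum_M, alphabetQT_zpow_neg' hm, h, piFinset_Icc_eq_intervalWords hm]
  refine Finset.sum_congr rfl fun w hw => ?_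
  have hw' : ∀ i, w i ∈ Set.Icc 1 ((m : ℤ) - 1) := by
    rw [← piFinset_Icc_eq_intervalWords hm, Fintype.mem_piFinset] at hw
    exact fun i => Finset.mem_Icc.1 (hw i)
  rw [onAlphabet, if_pos hw']

theorem neg_one_pow_mul_atSeries_gamma {P : Fin n → Fin n → Prop} (hnat : ∀ i j, P i j → i < j)
    {m : ℕ} (hm : 1 ≤ m) :
    (-1) ^ n * atSeries (alphabetQT (qL ^ (-(m : ℤ)))) (gamma P) =
      ∑ z ∈ interiorPoints P m, qL ^ (-∑ i, z i) := by
  have h := neg_one_pow_mul_sum_prodRight_lambdaNeg hnat (fun z => qL ^ (-z)) hm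
  simp only [prod_zpow_eq_zpow_sum qL_ne_zero, Finset.sum_neg_distrib] at h
  rw [gamma_eq_sum_weakWords P hnat, atSeries_sum_M, alphabetQT_zpow_neg' hm, h]

/-! ### The `q`-Ehrhart polynomial -/

/-- The coefficient of `S^I` in `σ_1(X_{q,t} A)`, as a polynomial in `x`, for `t = 1 + (q-1)x`. -/
noncomputable def alphabetPolynomial (I : List ℕ+) : (RatFunc ℚ)[X] :=
  ∑ k ∈ Finset.range (I.length + 1), C (SymSeries.qSigma qR (I.take k)) *
    ((C qR * (1 + (C qR - 1) * X)) ^ SymSeries.weight (I.drop k) *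
      C (SymSeries.qLambda qR (I.drop k)))

theorem eval₂_alphabetPolynomial (x : ℚ⸨X⸩) (I : List ℕ+) :
    (alphabetPolynomial I).eval₂ (ratToLaurent ℚ) x = alphabetQT (1 + (qL - 1) * x) I := by
  rw [alphabetQT_eq, alphabetPolynomial, eval₂_finsetSum]
  refine Finset.sum_congr rfl fun k _ => ?_
  simp [SymSeries.scale, eval₂_mul, eval₂_pow, eval₂_add, eval₂_sub, SymSeries.map_qSigma,
    SymSeries.map_qLambda, ratToLaurent_qR]

theorem qL_sub_one_ne_zero : qL - 1 ≠ 0 := by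
  have := qL_pow_ne_one 1 one_ne_zero
  rwa [pow_one, ← sub_ne_zero] at this

theorem ratToLaurent_qInt (m : ℤ) :
    1 + (qL - 1) * ratToLaurent ℚ (qInt m) = qL ^ m := by
  rw [qInt, map_div₀, map_sub, map_sub, map_one, map_zpow₀, ratToLaurent_qR,
    mul_div_cancel₀ _ qL_sub_one_ne_zero]
  ring

/-- The monomial `q^m` is recovered as `1 + (q-1)[m]_q`. Injectivity supplies infinitely many
interpolation points for uniqueness. -/
theorem qInt_injective : Function.Injective fun m : ℕ => qInt m := by
  intro a b hab
  have h := congrArg (fun x => 1 + (qL - 1) * ratToLaurent ℚ x) hab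
  simp only [ratToLaurent_qInt, qL_zpow] at h
  by_contra hne
  have h1 := congrArg (fun f : ℚ⸨X⸩ => f.coeff a) h
  simp only [HahnSeries.coeff_single_same] at h1
  rw [HahnSeries.coeff_single_of_ne (Nat.cast_injective.ne hne)] at h1
  exact one_ne_zero h1

theorem exists_qEhrhart {P : Fin n → Fin n → Prop} (hnat : ∀ i j, P i j → i < j) :
    ∃ L : (RatFunc ℚ)[X],
      (∀ x : LaurentSeries ℚ, atSeries (alphabetQT (1 + (qL - 1) * x)) (gamma P) =
        L.eval₂ (ratToLaurent ℚ) x) ∧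
      (∀ m : ℕ, L.eval (qInt m) = qCount P m) ∧
      ∀ m : ℕ, 1 ≤ m → (-1) ^ n * L.eval (qInt (-(m : ℤ))) =
          ∑ z ∈ interiorPoints P m, qR ^ (-∑ i, z i) := by
  obtain ⟨L, hL⟩ : ∃ L : (RatFunc ℚ)[X], ∀ x : LaurentSeries ℚ,
      atSeries (alphabetQT (1 + (qL - 1) * x)) (gamma P) = L.eval₂ (ratToLaurent ℚ) x := by
    refine ⟨∑ u ∈ weakWords P, alphabetPolynomial (evaluation u), fun x => ?_⟩
    rw [gamma_eq_sum_weakWords P hnat, atSeries_sum_M, eval₂_finsetSum]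
    simp only [eval₂_alphabetPolynomial]
  -- At `x = [m]_q` the parameter `t` is `q^m`, for either sign of `m`. Identities in `ℚ(q)` then
  -- follow from those in `ℚ((q))` by injectivity of the inclusion.
  have hev : ∀ m : ℤ, ratToLaurent ℚ (L.eval (qInt m)) = atSeries (alphabetQT (qL ^ m)) (gamma P) :=
    fun m => by rw [← ratToLaurent_qInt, hL, eval₂_at_apply]
  refine ⟨L, hL, fun m => (ratToLaurent ℚ).injective ?_,
    fun m hm => (ratToLaurent ℚ).injective ?_⟩
  · rw [hev, zpow_natCast, atSeries_gamma_pow hnat, qCount, map_sum]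
    simp only [map_zpow₀, ratToLaurent_qR]
  · rw [map_mul, map_pow, map_neg, map_one, hev, neg_one_pow_mul_atSeries_gamma hnat hm, map_sum]
    simp only [map_zpow₀, ratToLaurent_qR]

end NCEhrhart

/-! ### Assembly of the noncommutative, Ehrhart and `q`-Ehrhart statements -/

theorem mainTheorem10 {n : ℕ} (P : Fin n → Fin n → Prop) (hP : IsStrictOrder (Fin n) P)
    (hnat : ∀ i j, P i j → i < j) :
    -- the noncommutative Ehrhart polynomial
    gamma P = ∑ u ∈ weakWords P, M u ∧
    onAlphabet (Set.Ici 0) (gamma P) = sumOfWords (integerPoints (cone P)) ∧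
    (∀ m : ℕ, onAlphabet (Set.Icc 0 (m : ℤ)) (gamma P) =
      sumOfWords (integerPoints ((m : ℝ) • orderPolytope P))) ∧
    -- change of sign of the alphabet, and noncommutative reciprocity
    (∀ u : PackedWord n,
      negAlphabet (M u) = (-1 : ℚ) ^ maxLetter u.1 • ∑ v ∈ coarsenings u, M v) ∧
    (-1 : ℚ) ^ n • negAlphabet (gamma P) = ∑ v ∈ strictWords P, M v ∧
    (-1 : ℚ) ^ n • onAlphabet (Set.Ici 1) (negAlphabet (gamma P)) =
      ∑ v ∈ strictWords P, onAlphabet (Set.Ici 1) (M v) ∧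
    (-1 : ℚ) ^ n • onAlphabet (Set.Ici 1) (negAlphabet (gamma P)) =
      sumOfWords (integerPoints (interior (cone P))) ∧
    (∀ m : ℕ, 1 ≤ m →
      (-1 : ℚ) ^ n • onAlphabet (Set.Icc 1 ((m : ℤ) - 1)) (negAlphabet (gamma P)) =
        sumOfWords (integerPoints (interior ((m : ℝ) • orderPolytope P)))) ∧
    -- the Ehrhart polynomial and its reciprocity
    (∃ E : ℚ[X],
      (∀ m : ℕ, E.eval (m : ℚ) = ((points P m).card : ℚ)) ∧
      (∀ E' : ℚ[X], (∀ m : ℕ, E'.eval (m : ℚ) = ((points P m).card : ℚ)) → E' = E) ∧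
      (∀ α : ℚ, E.eval α = atScalar (α + 1) (gamma P)) ∧
      (∀ m : ℕ, 1 ≤ m →
        (-1 : ℚ) ^ n * atScalar (1 - (m : ℚ)) (gamma P) = ((interiorPoints P m).card : ℚ) ∧
        (-1 : ℚ) ^ n * E.eval (-(m : ℚ)) = ((interiorPoints P m).card : ℚ))) ∧
    -- the two infinite products defining the alphabet `X_{q,t}` converge
    (∀ I : List ℕ+, Tendsto
      (fun N => SymSeries.prodRight (fun i => SymSeries.sigma (qL ^ i)) N I) atTop
      (𝓝 (SymSeries.infProdRight (fun i => SymSeries.sigma (qL ^ i)) I))) ∧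
    (∀ (t : LaurentSeries ℚ) (I : List ℕ+), Tendsto
      (fun N => SymSeries.prodLeft (fun j => SymSeries.lambdaNeg (qL ^ (j + 1) * t)) N I) atTop
      (𝓝 (SymSeries.infProdLeft (fun j => SymSeries.lambdaNeg (qL ^ (j + 1) * t)) I))) ∧
    -- the specializations `t = q^m` and `t = q^{-m}`
    (∀ m : ℕ, alphabetQT (qL ^ m) =
      SymSeries.prodRight (fun i => SymSeries.sigma (qL ^ i)) (m + 1)) ∧
    (∀ m : ℕ, 1 ≤ m → alphabetQT (qL ^ (-(m : ℤ))) =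
      SymSeries.prodRight (fun i => SymSeries.lambdaNeg (qL ^ (-((i : ℤ) + 1)))) (m - 1)) ∧
    (∀ m : ℕ, atSeries (alphabetQT (qL ^ m)) (gamma P) = ∑ z ∈ points P m, qL ^ (∑ i, z i)) ∧
    (∀ m : ℕ, 1 ≤ m →
      atSeries (alphabetQT (qL ^ (-(m : ℤ)))) (gamma P) =
        (∑ w ∈ Fintype.piFinset (fun _ : Fin n => Finset.Icc (1 : ℤ) ((m : ℤ) - 1)),
          algebraMap ℚ (LaurentSeries ℚ)
            (onAlphabet (Set.Icc 1 ((m : ℤ) - 1)) (negAlphabet (gamma P)) w) *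
              ∏ i, qL ^ (-(w i))) ∧
      (-1) ^ n * atSeries (alphabetQT (qL ^ (-(m : ℤ)))) (gamma P) =
        ∑ z ∈ interiorPoints P m, qL ^ (-∑ i, z i)) ∧
    -- the `q`-Ehrhart polynomial, the `q`-Ehrhart series and `q`-reciprocity
    (∃ L : (RatFunc ℚ)[X],
      (∀ x : LaurentSeries ℚ, atSeries (alphabetQT (1 + (qL - 1) * x)) (gamma P) =
        L.eval₂ (ratToLaurent ℚ) x) ∧
      (∀ m : ℕ, L.eval (qInt m) = qCount P m) ∧
      (∀ L' : (RatFunc ℚ)[X], (∀ m : ℕ, L'.eval (qInt m) = qCount P m) → L' = L) ∧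
      PowerSeries.mk (fun m : ℕ => L.eval (qInt m)) = qEhrhartSeries P ∧
      (∀ m : ℕ, 1 ≤ m →
        (-1) ^ n * L.eval (qInt (-(m : ℤ))) =
          ∑ z ∈ interiorPoints P m, qR ^ (-∑ i, z i))) := by
  have hsign := neg_one_pow_smul_negAlphabet_gamma hnat
  obtain ⟨E, hE⟩ := exists_polynomial_atScalar hnat
  have hEpts : ∀ m : ℕ, E.eval (m : ℚ) = ((points P m).card : ℚ) := fun m => by
    rw [hE, atScalar_gamma_succ hnat]
  obtain ⟨L, hL, hLpts, hLneg⟩ := exists_qEhrhart hnat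
  refine ⟨gamma_eq_sum_weakWords P hnat, ?_, fun m => ?_, negAlphabet_M, hsign, ?_, ?_,
    fun m _ => ?_, ⟨E, hEpts, fun E' hE' => ?_, hE, fun m hm => ⟨atScalar_gamma_neg hnat hm, ?_⟩⟩,
    fun I => ?_, fun t I => ?_, alphabetQT_pow, fun m => alphabetQT_zpow_neg,
    atSeries_gamma_pow hnat, fun m hm => ⟨atSeries_gamma_zpow_neg hnat hm,
      neg_one_pow_mul_atSeries_gamma hnat hm⟩,
    ⟨L, hL, hLpts, fun L' hL' => ?_, ?_, hLneg⟩⟩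
  · rw [gamma_eq_sum_weakWords P hnat]
    refine onAlphabet_sum_M _ _ _ fun z => ?_
    rw [pack_mem_weakWords, mem_integerPoints_cone]
  · rw [gamma_eq_sum_weakWords P hnat]
    refine onAlphabet_sum_M _ _ _ fun z => ?_
    rw [pack_mem_weakWords, mem_integerPoints_smul]
  · rw [← onAlphabet_smul, hsign, onAlphabet_sum]
  · rw [← onAlphabet_smul, hsign]
    refine onAlphabet_sum_M _ _ _ fun z => ?_
    rw [pack_mem_strictWords, mem_integerPoints_interior_cone hnat]
  · rw [← onAlphabet_smul, hsign]
    refine onAlphabet_sum_M _ _ _ fun z => ?_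
    rw [pack_mem_strictWords, mem_integerPoints_interior_smul hnat]
  · exact polynomial_eq_of_eval_natSeq (s := fun m : ℕ => (m : ℚ)) Nat.cast_injective
      fun m => (hE' m).trans (hEpts m).symm
  · rw [hE, ← atScalar_gamma_neg hnat hm, neg_add_eq_sub]
  · rw [infProdRight_eq]
    exact SymSeries.tendsto_prodRight_sigma qL_pow_ne_one tendsto_qL_pow I
  · rw [infProdLeft_eq]
    exact SymSeries.tendsto_prodLeft_lambdaNeg qL_pow_ne_one tendsto_qL_pow t I
  · exact polynomial_eq_of_eval_natSeq qInt_injective fun m => (hL' m).trans (hLpts m).symm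
  · simp only [hLpts, qEhrhartSeries]
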